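/- **Theorem.** Let $D\subset\mathbb C$ be a domain (open, connected) containing $[-1,1]$, and let $V:D\to\mathbb C$ be holomorphic. For $h>0$ let $H^h=H^h_0=-h^2\frac{d^2}{dx^2}+V(x)$ on $L^2([-1,1];\mathbb C)$ with domain $\{u\in L^2 : u''\in L^2,\ u(-1)=u(1)=0\}$, and let $\mathrm{Sp}(H^h)$ be its spectrum. The limit spectrum $\lim_h\mathrm{Sp}(H^h)$ is the set of all $E_0\in\mathbb C$ for which there are $h_j>0$, $h_j\to0$, and $E_j\in\mathrm{Sp}(H^{h_j})$ with $E_j\to E_0$. For $E\in\mathbb C$ a *turning point* is a zero $a\in D$ of $V-E$, and the *Stokes line* starting from $a$ is the set of the points that can be reached from $a$ by a $C^1$ curve $\gamma:[0,1]\to D$, $\gamma(0)=a$ (whose velocity may vanish), with $\mathrm{Re}\int_0^t\sqrt{V(\gamma(s))-E}\,\gamma'(s)\,ds=0$ for all $t\in[0,1]$, for a continuous branch of the square root along $\gamma$. We say that a property holds *for $E$ large with small imaginary part* if there are $R,\varepsilon>0$ such that it holds for all $E\in\mathbb C$ with $|E|\ge R$ and $|\mathrm{Im}\,E|\le\varepsilon|E|$.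 Assume: * **(H1)** for every relatively compact $\Omega\subset\mathbb C$, the set $V^{-1}(\Omega)\subset D$ is bounded; * **(H2)** for $E$ large with small imaginary part, $-1$ and $1$ belong to the same Stokes region, i.e. they can be joined by a continuous path in $D$ that does not meet the Stokes lines starting from the turning points. Then there is a constant $C>0$ such that, for $E_0$ large with small imaginary part, 1. $\displaystyle \mathrm{Re}\int_{-1}^{1}\sqrt{V(x)-E_0}\,dx=0$ if and only if $E_0\in\lim_h\mathrm{Sp}(H^h_0)$, where $\sqrt{V-E_0}$ is a continuous branch of the square root on $[-1,1]$; 2. if $\mathrm{Re}\int_{-1}^{1}\sqrt{V(x)-E_0}\,dx=0$, then there is $h_0>0$ such that for every $h\in(0,h_0)$ there is an eigenvalue $E_h\in\mathrm{Sp}(H^h_0)$ of $H^h_0$ with $|\sqrt{E_h}-\sqrt{E_0}|\le C\,h$ (principal square roots). The constants $C,R,\varepsilon$ in the conclusion depend only on $V$, and $h_0$ may depend on $E_0$. -/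

import Mathlib

open Set Filter Topology MeasureTheory

/-- `w` is a continuous branch of `(V - E)^{1/2}` along the curve `γ : [a, b] → ℂ`. -/
def IsSqrtBranch (V : ℂ → ℂ) (E : ℂ) (γ : ℝ → ℂ) (a b : ℝ) (w : ℝ → ℂ) : Prop :=
  ContinuousOn w (Icc a b) ∧ ∀ t ∈ Icc a b, w t ^ 2 = V (γ t) - E

/-- `Re ∫_{-1}^{1} √(V(x) - E) dx = 0`, the square root being a continuous branch on `[-1, 1]`.
When `V - E` has no zero on `[-1, 1]` there are exactly two such branches, and they differ by a
sign, so the condition does not depend on the choice. -/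
def ActionReZero (V : ℂ → ℂ) (E : ℂ) : Prop :=
  ∃ w : ℝ → ℂ, IsSqrtBranch V E (fun x : ℝ => (x : ℂ)) (-1) 1 w ∧
    (∫ x in (-1 : ℝ)..1, w x).re = 0

/-- The Stokes line starting from `a`, for the potential `V` on `D` and the energy `E`: the set of
the points that can be reached from `a` by a curve in `D` along which
`Re ∫_a^{γ(t)} (V - E)^{1/2}` stays equal to `0`. The curve is `C¹`; its velocity may vanish, so
that it may turn at turning points. -/
def stokesLine (D : Set ℂ) (V : ℂ → ℂ) (E a : ℂ) : Set ℂ :=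
  {y | ∃ γ : ℝ → ℂ, ContDiff ℝ 1 γ ∧ MapsTo γ (Icc 0 1) D ∧ γ 0 = a ∧ γ 1 = y ∧
    ∃ w : ℝ → ℂ, IsSqrtBranch V E γ 0 1 w ∧
      ∀ t ∈ Icc (0 : ℝ) 1, (∫ s in (0 : ℝ)..t, w s * deriv γ s).re = 0}

/-- The union of the Stokes lines that issue from the turning points, that is, from the zeros of
`V - E` in `D`. -/
def stokesLines (D : Set ℂ) (V : ℂ → ℂ) (E : ℂ) : Set ℂ :=
  ⋃ a ∈ {a | a ∈ D ∧ V a = E}, stokesLine D V E a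

/-- `E` is large with small imaginary part: `|E| ≥ R` and `|Im E| ≤ ε |E|`. -/
def LargeNearReal (R ε : ℝ) (E : ℂ) : Prop :=
  R ≤ ‖E‖ ∧ |E.im| ≤ ε * ‖E‖

/-- (H1): the preimage under `V : D → ℂ` of a relatively compact set is bounded. -/
def HypH1 (D : Set ℂ) (V : ℂ → ℂ) : Prop :=
  ∀ Ω : Set ℂ, IsCompact (closure Ω) → Bornology.IsBounded (D ∩ V ⁻¹' Ω)

/-- (H2): for `E` large with small imaginary part, `-1` and `1` belong to the same Stokes region,
that is, a path in `D` from `-1` to `1` avoids the Stokes lines issuing from the turning points. -/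
def HypH2 (D : Set ℂ) (V : ℂ → ℂ) : Prop :=
  ∃ R > (0 : ℝ), ∃ ε > (0 : ℝ), ∀ E : ℂ, LargeNearReal R ε E →
    JoinedIn (D \ stokesLines D V E) (-1) 1

/-- Lebesgue measure on `[-1, 1]`. -/
noncomputable abbrev μI : Measure ℝ := volume.restrict (Icc (-1) 1)

/-- The Hilbert space `L²([-1, 1]; ℂ)`. -/
noncomputable abbrev L2I : Type := Lp ℂ 2 μI

/-- On `[-1, 1]`, `u` and its derivative `u'` are absolutely continuous, `u''` is the almost
everywhere derivative of `u'` and lies in `L²`, and `u(-1) = u(1) = 0`. -/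
structure IsDirichletH2 (u u' u'' : ℝ → ℂ) : Prop where
  memLp : MemLp u'' 2 μI
  eq_integral_deriv : ∀ x ∈ Icc (-1 : ℝ) 1, u x = u (-1) + ∫ s in (-1 : ℝ)..x, u' s
  deriv_eq_integral : ∀ x ∈ Icc (-1 : ℝ) 1, u' x = u' (-1) + ∫ s in (-1 : ℝ)..x, u'' s
  left : u (-1) = 0
  right : u 1 = 0

/-- The graph of the Dirichlet operator `H^h = -h² d²/dx² + V` on `L²([-1, 1])`, with domain
`{u ∈ L² | u'' ∈ L², u(-1) = u(1) = 0}`: `u` is in the domain and `H^h u = f`. -/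
def HGraph (h : ℝ) (V : ℂ → ℂ) (u f : L2I) : Prop :=
  ∃ U U' U'' : ℝ → ℂ, IsDirichletH2 U U' U'' ∧ u =ᵐ[μI] U ∧
    f =ᵐ[μI] fun x => -(h : ℂ) ^ 2 * U'' x + V (x : ℂ) * U x

/-- The spectrum of `H^h`: the set of the `E` for which `H^h - E` has no bounded everywhere defined
two-sided inverse `R`. (`u` is in the domain with `(H^h - E) u = g` exactly when `u = R g`; here
`g = f - E u` with `f = H^h u`.) -/
def Sp (h : ℝ) (V : ℂ → ℂ) : Set ℂ :=
  {E | ¬ ∃ R : L2I →L[ℂ] L2I, ∀ u f : L2I, HGraph h V u f ↔ u = R (f - E • u)}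

/-- `E` is an eigenvalue of `H^h`. -/
def IsEigenvalue (h : ℝ) (V : ℂ → ℂ) (E : ℂ) : Prop :=
  ∃ u : L2I, u ≠ 0 ∧ HGraph h V u (E • u)

/-- The limit spectrum `lim_h Sp(H^h)`: the limits of sequences `E_j ∈ Sp(H^{h_j})` with
`h_j → 0`, `h_j > 0`. -/
def limSp (V : ℂ → ℂ) : Set ℂ :=
  {E₀ | ∃ (h : ℕ → ℝ) (E : ℕ → ℂ), (∀ j, 0 < h j) ∧ Tendsto h atTop (𝓝 0) ∧
    (∀ j, E j ∈ Sp (h j) V) ∧ Tendsto E atTop (𝓝 E₀)}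

/-! The proof is a shooting argument combined with a Liouville–Green (WKB) approximation. Let `φ_E`
solve `h² u'' = (V - E) u` with `u(-1) = 0`, `u'(-1) = 1`. A zero of `φ_E(1)` makes `φ_E` an
eigenfunction; otherwise the Green function inverts `H^h - E`. So the spectrum is the zero set of `E
↦ φ_E(1)`, which is entire (`differentiable_shooting`).

For `E` near a large `E₀`, put `s = (E - V)^{1/4}`, `ζ = ∫ (E - V)^{1/2}` and `Z(E) = ζ(1)`. In the
variable `ζ`, `w = s u` solves `w'' = (-1/h² + b) w` with `b` bounded. Hence `G_h(E) = s(1) s(-1)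
φ_E(1) / h` equals `sin (Z(E)/h)` up to `O(h exp(|Im Z|/h))` (`norm_shooting_sub_sin_le`). For an
error on the scale of the sine itself, the equation is integrated along a curve that `ζ` maps onto
the straight segment from `0` to `Z`. Such a curve exists close to `[-1, 1]` because `(E - V)/E₀` is
close to `1` (`exists_curve_to_segment`).

Since `√(V - E₀) = ± i √(E₀ - V)`, the action condition says that `Z(E₀)` is real. If it is not,
`|sin (Z/h)|` exceeds the error for `E` near `E₀` and small `h`, so no spectrum accumulates at `E₀`
(`ne_zero_near`). If it is, a zero `kπh` of `sin (·/h)` lies within `2h` of `Z(E₀)`, and the minimum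
principle gives a zero of `G_h` nearby (`exists_zero_near`). As `|Z'(E₀)|` is at least `1 / (2
|√E₀|)`, this costs `O(|√E₀| h)` in `E`, hence `O(h)` in `√E` with an absolute constant. -/

/-! ### Holomorphic solutions of `u'' = Q u`. -/

/-- A function vanishing at `c` whose derivative is at most `B |z - c| ^ k` on a convex set is at
most `B |z - c| ^ (k + 1) / (k + 1)` there. -/
theorem norm_le_of_norm_deriv_le_pow {N : Set ℂ} (hN : Convex ℝ N) {c : ℂ} (hc : c ∈ N)
    {f f' : ℂ → ℂ} (hf : ∀ z ∈ N, HasDerivAt f (f' z) z) (hfc : f c = 0) {B : ℝ} {k : ℕ}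
    (hB : ∀ z ∈ N, ‖f' z‖ ≤ B * ‖z - c‖ ^ k) {z : ℂ} (hz : z ∈ N) :
    ‖f z‖ ≤ B * ‖z - c‖ ^ (k + 1) / (k + 1) := by
  set γ : ℝ → ℂ := fun t => c + t * (z - c) with hγ
  have hmem : ∀ t ∈ Icc (0 : ℝ) 1, γ t ∈ N := by
    intro t ht
    have := hN.add_smul_sub_mem hc hz ht
    simpa [hγ] using this
  have hγd : ∀ t, HasDerivAt γ (z - c) t := by
    intro t
    simpa [hγ] using ((Complex.ofRealCLM.hasDerivAt (x := t)).mul_const (z - c)).const_add c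
  have hg : ∀ t ∈ Icc (0 : ℝ) 1, HasDerivAt (fun t => f (γ t)) (f' (γ t) * (z - c)) t :=
    fun t ht => (hf _ (hmem t ht)).comp t (hγd t)
  have key := image_norm_le_of_norm_deriv_right_le_deriv_boundary (a := (0 : ℝ)) (b := 1)
    (f := fun t => f (γ t)) (f' := fun t => f' (γ t) * (z - c))
    (B := fun t => B * ‖z - c‖ ^ (k + 1) / (k + 1) * t ^ (k + 1))
    (B' := fun t => B * ‖z - c‖ ^ (k + 1) / (k + 1) * ((k + 1 : ℕ) * t ^ k))
    (fun t ht => (hg t ht).continuousAt.continuousWithinAt)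
    (fun t ht => (hg t ⟨ht.1, ht.2.le⟩).hasDerivWithinAt)
    (by simp [hγ, hfc]) (fun t => by simpa using (hasDerivAt_pow (k + 1) t).const_mul _) ?_
    (right_mem_Icc.2 zero_le_one)
  · simpa [hγ] using key
  · intro t ht
    have h1 := hB _ (hmem t ⟨ht.1, ht.2.le⟩)
    have h2 : ‖γ t - c‖ = t * ‖z - c‖ := by
      simp [hγ, abs_of_nonneg ht.1]
    rw [norm_mul]
    calc ‖f' (γ t)‖ * ‖z - c‖ ≤ B * ‖γ t - c‖ ^ k * ‖z - c‖ := by gcongr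
      _ = _ := by
        rw [h2]; push_cast; field_simp; ring

theorem exists_primitive_vanishing_at {N : Set ℂ} (hN : Convex ℝ N) (hNo : IsOpen N) (c : ℂ)
    {f : ℂ → ℂ} (hf : DifferentiableOn ℂ f N) :
    ∃ g : ℂ → ℂ, (∀ z ∈ N, HasDerivAt g (f z) z) ∧ g c = 0 := by
  obtain ⟨g, hg⟩ := hN.exists_forall_hasDerivWithinAt hf
  exact ⟨fun z => g z - g c, fun z hz => ((hg z hz).hasDerivAt (hNo.mem_nhds hz)).sub_const _,
    by simp⟩

/-- `u` solves `u'' = Q u` on `N`, with derivative `u'`. -/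
structure IsLinSol (N : Set ℂ) (Q u u' : ℂ → ℂ) : Prop where
  hasDerivAt : ∀ z ∈ N, HasDerivAt u (u' z) z
  hasDerivAt_deriv : ∀ z ∈ N, HasDerivAt u' (Q z * u z) z

/-- Existence of holomorphic solutions of `u'' = Q u` on a bounded convex open set. -/
theorem exists_isLinSol {N : Set ℂ} (hN : Convex ℝ N) (hNo : IsOpen N)
    {c : ℂ} (hc : c ∈ N) {Q : ℂ → ℂ} (hQ : DifferentiableOn ℂ Q N) {K r : ℝ}
    (hK : ∀ z ∈ N, ‖Q z‖ ≤ K) (hr : ∀ z ∈ N, ‖z - c‖ ≤ r) (a b : ℂ) :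
    ∃ u u' : ℂ → ℂ, IsLinSol N Q u u' ∧ u c = a ∧ u' c = b := by
  have hK0 : 0 ≤ K := (norm_nonneg _).trans (hK c hc)
  have hr0 : 0 ≤ r := (norm_nonneg _).trans (hr c hc)
  have step : ∀ v : {v : ℂ → ℂ // DifferentiableOn ℂ v N}, ∃ p : (ℂ → ℂ) × (ℂ → ℂ),
      (∀ z ∈ N, HasDerivAt p.1 (p.2 z) z) ∧ (∀ z ∈ N, HasDerivAt p.2 (Q z * v.1 z) z) ∧
      p.1 c = 0 ∧ p.2 c = 0 := by
    rintro ⟨v, hv⟩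
    obtain ⟨g, hg, hgc⟩ := exists_primitive_vanishing_at hN hNo c (hQ.mul hv)
    obtain ⟨f, hf, hfc⟩ := exists_primitive_vanishing_at hN hNo c
      (fun z hz => (hg z hz).differentiableAt.differentiableWithinAt)
    exact ⟨(f, g), hf, hg, hfc, hgc⟩
  choose P hP1 hP2 hP3 hP4 using step
  -- Picard series: `v 0` is the affine function with the given data, `v (n + 1)'' = Q * v n` with
  -- zero data at `c`, and the sum of the `v n` is the solution. `w` and `q` are the first and
  -- second derivatives of `v`.
  let v0 : ℂ → ℂ := fun z => a + b * (z - c)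
  have hv0 : ∀ z, HasDerivAt v0 b z := fun z => by
    have h := (((hasDerivAt_id z).sub_const c).const_mul b).const_add a
    rwa [mul_one] at h
  let S : ℕ → {v : ℂ → ℂ // DifferentiableOn ℂ v N} := fun n => Nat.rec
    ⟨v0, fun z _ => (hv0 z).differentiableAt.differentiableWithinAt⟩
    (fun _ v => ⟨(P v).1, fun z hz => (hP1 v z hz).differentiableAt.differentiableWithinAt⟩) n
  let v : ℕ → ℂ → ℂ := fun n => (S n).1
  let w : ℕ → ℂ → ℂ := fun n => Nat.casesOn n (fun _ => b) (fun m => (P (S m)).2)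
  let q : ℕ → ℂ → ℂ := fun n => Nat.casesOn n (fun _ => 0) (fun m z => Q z * v m z)
  have hvw : ∀ n, ∀ z ∈ N, HasDerivAt (v n) (w n z) z := by
    rintro (_ | n) z hz
    · exact hv0 z
    · exact hP1 (S n) z hz
  have hwq : ∀ n, ∀ z ∈ N, HasDerivAt (w n) (q n z) z := by
    rintro (_ | n) z hz
    · exact hasDerivAt_const _ _
    · exact hP2 (S n) z hz
  set A : ℝ := ‖a‖ + ‖b‖ * r with hA
  have hA0 : 0 ≤ A := by positivity
  have hwbound : ∀ n, (∀ z ∈ N, ‖v n z‖ ≤ A * K ^ n / (2 * n).factorial * ‖z - c‖ ^ (2 * n)) →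
      ∀ z ∈ N, ‖w (n + 1) z‖ ≤
        A * K ^ (n + 1) / (2 * n + 1).factorial * ‖z - c‖ ^ (2 * n + 1) := by
    intro n ih z hz
    have h := norm_le_of_norm_deriv_le_pow (B := K * (A * K ^ n / (2 * n).factorial))
      (k := 2 * n) hN hc (hwq (n + 1)) (hP4 (S n)) (fun y hy => ?_) hz
    · refine h.trans_eq ?_
      rw [Nat.factorial_succ]; push_cast; field_simp; ring
    · rw [show q (n + 1) y = Q y * v n y from rfl, norm_mul, mul_assoc]
      exact mul_le_mul (hK y hy) (ih y hy) (norm_nonneg _) hK0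
  have hvbound : ∀ n, ∀ z ∈ N,
      ‖v n z‖ ≤ A * K ^ n / (2 * n).factorial * ‖z - c‖ ^ (2 * n) := by
    intro n
    induction n with
    | zero =>
      intro z hz
      have : ‖v 0 z‖ ≤ ‖a‖ + ‖b‖ * ‖z - c‖ := (norm_add_le _ _).trans (by rw [norm_mul])
      have h2 := mul_le_mul_of_nonneg_left (hr z hz) (norm_nonneg b)
      simp only [pow_zero, mul_one, Nat.mul_zero, Nat.factorial_zero, Nat.cast_one, div_one]
      linarith
    | succ n ih =>
      intro z hz
      have h := norm_le_of_norm_deriv_le_pow hN hc (hvw (n + 1)) (hP3 (S n)) (hwbound n ih) hz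
      refine h.trans_eq ?_
      rw [show 2 * (n + 1) = 2 * n + 1 + 1 by ring, Nat.factorial_succ (2 * n + 1)]
      push_cast; field_simp
  -- Weakening `(2n)!` and `(2n + 1)!` to `n!` lets one exponential series dominate both derivative
  -- series.
  have hfac : ∀ m n : ℕ, n ≤ m → (1 : ℝ) / m.factorial ≤ 1 / n.factorial := fun m n h =>
    one_div_le_one_div_of_le (by positivity) (by exact_mod_cast Nat.factorial_le h)
  have hsum : Summable fun n : ℕ => (K * r ^ 2) ^ n / (n.factorial : ℝ) :=
    Real.summable_pow_div_factorial _
  have hwU : ∃ U : ℕ → ℝ, Summable U ∧ ∀ n, ∀ z ∈ N, ‖w n z‖ ≤ U n := by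
    let U : ℕ → ℝ := fun n =>
      Nat.casesOn n ‖b‖ fun m => A * K * r * ((K * r ^ 2) ^ m / m.factorial)
    have hU : Summable fun m => U (m + 1) := hsum.mul_left (A * K * r)
    refine ⟨U, (summable_nat_add_iff 1).1 hU, ?_⟩
    rintro (_ | n) z hz
    · exact le_rfl
    · change ‖w (n + 1) z‖ ≤ A * K * r * ((K * r ^ 2) ^ n / n.factorial)
      refine (hwbound n (hvbound n) z hz).trans ?_
      have h1 := pow_le_pow_left₀ (norm_nonneg _) (hr z hz) (2 * n + 1)
      have h2 := hfac (2 * n + 1) n (by omega)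
      calc A * K ^ (n + 1) / (2 * n + 1).factorial * ‖z - c‖ ^ (2 * n + 1)
          = A * K ^ (n + 1) * (1 / (2 * n + 1).factorial) * ‖z - c‖ ^ (2 * n + 1) := by ring
        _ ≤ A * K ^ (n + 1) * (1 / n.factorial) * r ^ (2 * n + 1) := by gcongr
        _ = A * K * r * ((K * r ^ 2) ^ n / n.factorial) := by ring
  have hqU : ∃ U : ℕ → ℝ, Summable U ∧ ∀ n, ∀ z ∈ N, ‖q n z‖ ≤ U n := by
    let U : ℕ → ℝ := fun n =>
      Nat.casesOn n 0 fun m => K * A * ((K * r ^ 2) ^ m / m.factorial)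
    have hU : Summable fun m => U (m + 1) := hsum.mul_left (K * A)
    refine ⟨U, (summable_nat_add_iff 1).1 hU, ?_⟩
    rintro (_ | n) z hz
    · exact (norm_zero (E := ℂ)).le
    · change ‖Q z * v n z‖ ≤ K * A * ((K * r ^ 2) ^ n / n.factorial)
      have h1 := pow_le_pow_left₀ (norm_nonneg _) (hr z hz) (2 * n)
      have h2 := hfac (2 * n) n (by omega)
      calc ‖Q z * v n z‖ ≤ K * (A * K ^ n / (2 * n).factorial * ‖z - c‖ ^ (2 * n)) := by
            rw [norm_mul]
            exact mul_le_mul (hK z hz) (hvbound n z hz) (norm_nonneg _) hK0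
        _ = K * (A * K ^ n * (1 / (2 * n).factorial) * ‖z - c‖ ^ (2 * n)) := by ring
        _ ≤ K * (A * K ^ n * (1 / n.factorial) * r ^ (2 * n)) := by gcongr
        _ = K * A * ((K * r ^ 2) ^ n / n.factorial) := by ring
  obtain ⟨U, hU, hwU⟩ := hwU
  obtain ⟨U', hU', hqU⟩ := hqU
  have hvc : ∀ n, n ≠ 0 → v n c = 0 := by
    rintro (_ | n) h
    · exact absurd rfl h
    · exact hP3 (S n)
  have hwc : ∀ n, n ≠ 0 → w n c = 0 := by
    rintro (_ | n) h
    · exact absurd rfl h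
    · exact hP4 (S n)
  have hpre : IsPreconnected N := hN.isPreconnected
  have hsv : Summable fun n => v n c := summable_of_ne_finset_zero (s := {0})
    fun n hn => hvc n (by simpa using hn)
  have hsw : Summable fun n => w n c := summable_of_ne_finset_zero (s := {0})
    fun n hn => hwc n (by simpa using hn)
  refine ⟨fun z => ∑' n, v n z, fun z => ∑' n, w n z, ⟨fun z hz => ?_, fun z hz => ?_⟩, ?_, ?_⟩
  · exact hasDerivAt_tsum_of_isPreconnected hU hNo hpre hvw hwU hc hsv hz
  · have h := hasDerivAt_tsum_of_isPreconnected hU' hNo hpre hwq hqU hc hsw hz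
    have hq : Summable fun n => q n z := .of_norm_bounded hU' fun n => hqU n z hz
    rw [hq.tsum_eq_zero_add] at h
    simpa [q, tsum_mul_left] using h
  · simp only
    rw [tsum_eq_single 0 hvc]; simp [v, S, v0]
  · exact tsum_eq_single 0 hwc

/-! ### Absolutely continuous functions on `[-1, 1]`. -/

/-- Split into real and imaginary parts, where the real-valued result applies. -/
theorem absolutelyContinuousOnInterval_integral_complex {f : ℝ → ℂ} {a b c : ℝ}
    (hf : IntervalIntegrable f volume a b) (hc : c ∈ uIcc a b) :
    AbsolutelyContinuousOnInterval (fun x => ∫ v in c..x, f v) a b := by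
  have hre : IntervalIntegrable (fun x => (f x).re) volume a b := ⟨hf.1.re, hf.2.re⟩
  have him : IntervalIntegrable (fun x => (f x).im) volume a b := ⟨hf.1.im, hf.2.im⟩
  have hconst : ∀ z : ℂ, AbsolutelyContinuousOnInterval (fun _ : ℝ => z) a b := fun z =>
    (LipschitzOnWith.of_dist_le_mul (K := 0) (by simp)).absolutelyContinuousOnInterval
  have h1 := (hre.absolutelyContinuousOnInterval_intervalIntegral hc).smul (hconst 1)
  have h2 := (him.absolutelyContinuousOnInterval_intervalIntegral hc).smul (hconst Complex.I)
  have h3 := h1.add h2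
  rw [absolutelyContinuousOnInterval_iff] at h3 ⊢
  have key : ∀ x ∈ uIcc a b, (∫ v in c..x, f v) =
      (((fun x => ∫ v in c..x, (f v).re) • fun _ : ℝ => (1 : ℂ)) +
        ((fun x => ∫ v in c..x, (f v).im) • fun _ : ℝ => Complex.I)) x := by
    intro x hx
    have hi : IntervalIntegrable f volume c x :=
      hf.mono_set (uIcc_subset_uIcc hc hx)
    have e1 : (∫ v in c..x, (f v).re) = (∫ v in c..x, f v).re :=
      Complex.reCLM.intervalIntegral_comp_comm hi
    have e2 : (∫ v in c..x, (f v).im) = (∫ v in c..x, f v).im :=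
      Complex.imCLM.intervalIntegral_comp_comm hi
    simp [e1, e2, Complex.re_add_im]
  intro ε hε
  obtain ⟨δ, hδ, h⟩ := h3 ε hε
  refine ⟨δ, hδ, fun E hE hs => ?_⟩
  have := h E hE hs
  refine (Finset.sum_congr rfl fun i hi => ?_).trans_lt this
  have hm := hE.1 i hi
  rw [key _ hm.1, key _ hm.2]

/-- `A` is absolutely continuous on `[-1, 1]`, with almost everywhere derivative `α`. -/
structure HasIntegralDeriv (A α : ℝ → ℂ) : Prop where
  integrable : IntervalIntegrable α volume (-1) 1
  eq : ∀ x ∈ Icc (-1 : ℝ) 1, A x = A (-1) + ∫ s in (-1 : ℝ)..x, α s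

namespace HasIntegralDeriv

variable {A B α β : ℝ → ℂ}

theorem integrable_left (h : HasIntegralDeriv A α) {x : ℝ} (hx : x ∈ Icc (-1 : ℝ) 1) :
    IntervalIntegrable α volume (-1) x :=
  h.integrable.mono_set (by
    rw [uIcc_of_le hx.1, uIcc_of_le (by norm_num)]; exact Icc_subset_Icc le_rfl hx.2)

theorem continuousOn (h : HasIntegralDeriv A α) : ContinuousOn A (Icc (-1) 1) := by
  have h1 := (absolutelyContinuousOnInterval_integral_complex h.integrable
    (c := -1) left_mem_uIcc).continuousOn
  rw [uIcc_of_le (by norm_num)] at h1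
  exact (continuousOn_const.add h1).congr h.eq

theorem of_hasDerivAt (hA : ∀ x ∈ Icc (-1 : ℝ) 1, HasDerivAt A (α x) x)
    (hα : ContinuousOn α (Icc (-1) 1)) : HasIntegralDeriv A α := by
  have hi : IntervalIntegrable α volume (-1) 1 :=
    ContinuousOn.intervalIntegrable (by rwa [uIcc_of_le (by norm_num)])
  refine ⟨hi, fun x hx => ?_⟩
  have hsub : uIcc (-1) x ⊆ Icc (-1 : ℝ) 1 := by
    rw [uIcc_of_le hx.1]; exact Icc_subset_Icc le_rfl hx.2
  rw [intervalIntegral.integral_eq_sub_of_hasDerivAt (fun y hy => hA y (hsub hy))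
    (hα.mono hsub).intervalIntegrable]
  ring

theorem const (c : ℂ) : HasIntegralDeriv (fun _ => c) (fun _ => 0) :=
  of_hasDerivAt (fun x _ => hasDerivAt_const x c) continuousOn_const

theorem integral (hα : IntervalIntegrable α volume (-1) 1) :
    HasIntegralDeriv (fun x => ∫ s in (-1 : ℝ)..x, α s) α :=
  ⟨hα, fun x _ => by simp⟩

theorem add (hA : HasIntegralDeriv A α) (hB : HasIntegralDeriv B β) :
    HasIntegralDeriv (fun x => A x + B x) (fun x => α x + β x) := by
  refine ⟨hA.integrable.add hB.integrable, fun x hx => ?_⟩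
  rw [intervalIntegral.integral_add (hA.integrable_left hx) (hB.integrable_left hx),
    hA.eq x hx, hB.eq x hx]
  ring

theorem const_mul (c : ℂ) (hA : HasIntegralDeriv A α) :
    HasIntegralDeriv (fun x => c * A x) (fun x => c * α x) := by
  refine ⟨hA.integrable.const_mul c, fun x hx => ?_⟩
  rw [intervalIntegral.integral_const_mul, hA.eq x hx]
  ring

theorem congr {A' α' : ℝ → ℂ} (hA : HasIntegralDeriv A α) (h : ∀ x, A' x = A x)
    (h' : ∀ x, α' x = α x) : HasIntegralDeriv A' α' := by
  obtain rfl : A' = A := funext h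
  obtain rfl : α' = α := funext h'
  exact hA

/-- The product minus the integral of the expected derivative is absolutely continuous with
derivative zero almost everywhere, hence constant. This supplies integration by parts for functions
in the operator domain. -/
theorem mul (hA : HasIntegralDeriv A α) (hB : HasIntegralDeriv B β) :
    HasIntegralDeriv (fun x => A x * B x) (fun x => α x * B x + A x * β x) := by
  have hI : uIcc (-1 : ℝ) 1 = Icc (-1) 1 := uIcc_of_le (by norm_num)
  have hcA := hI ▸ hA.continuousOn
  have hcB := hI ▸ hB.continuousOn
  have hi : IntervalIntegrable (fun x => α x * B x + A x * β x) volume (-1) 1 :=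
    (hA.integrable.mul_continuousOn hcB).add (hB.integrable.continuousOn_mul hcA)
  refine ⟨hi, fun x hx => ?_⟩
  have hconst : ∀ z : ℂ, AbsolutelyContinuousOnInterval (fun _ : ℝ => z) (-1) 1 := fun z =>
    (LipschitzOnWith.of_dist_le_mul (K := 0) (by simp)).absolutelyContinuousOnInterval
  have acA := (hconst (A (-1))).add
    (absolutelyContinuousOnInterval_integral_complex hA.integrable (c := -1) left_mem_uIcc)
  have acB := (hconst (B (-1))).add
    (absolutelyContinuousOnInterval_integral_complex hB.integrable (c := -1) left_mem_uIcc)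
  have acI := absolutelyContinuousOnInterval_integral_complex hi (c := -1) left_mem_uIcc
  obtain ⟨C, hC⟩ := ((acA.smul acB).sub acI).const_of_ae_hasDerivAt_zero (by
    filter_upwards [hA.integrable.ae_hasDerivAt_integral, hB.integrable.ae_hasDerivAt_integral,
      hi.ae_hasDerivAt_integral] with y h1 h2 h3 hy
    have d1 := (h1 hy (-1) left_mem_uIcc).const_add (A (-1))
    have d2 := (h2 hy (-1) left_mem_uIcc).const_add (B (-1))
    have d3 := (d1.mul d2).sub (h3 hy (-1) left_mem_uIcc)
    refine d3.congr_deriv ?_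
    rw [← hA.eq y (hI ▸ hy), ← hB.eq y (hI ▸ hy)]
    ring)
  have e1 := hC (-1) left_mem_uIcc
  have e2 := hC x (hI ▸ hx)
  simp only [Pi.sub_apply, smul_eq_mul, Pi.mul_apply, Pi.add_apply, intervalIntegral.integral_same,
    add_zero, sub_zero] at e1 e2
  rw [← hA.eq x hx, ← hB.eq x hx, ← e1] at e2
  linear_combination e2

end HasIntegralDeriv

theorem memLp_of_continuousOn {f : ℝ → ℂ} (hf : ContinuousOn f (Icc (-1) 1)) :
    MemLp f 2 μI := by
  obtain ⟨C, hC⟩ := isCompact_Icc.exists_bound_of_continuousOn hf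
  exact MemLp.of_bound (hf.aestronglyMeasurable measurableSet_Icc) C
    ((ae_restrict_iff' measurableSet_Icc).2 (ae_of_all _ hC))

theorem intervalIntegrable_of_memLp {f : ℝ → ℂ} (hf : MemLp f 2 μI) :
    IntervalIntegrable f volume (-1) 1 := by
  rw [intervalIntegrable_iff_integrableOn_Icc_of_le (by norm_num)]
  exact hf.integrable one_le_two

namespace IsDirichletH2

variable {u u' u'' : ℝ → ℂ}

theorem hasIntegralDeriv_deriv (hu : IsDirichletH2 u u' u'') : HasIntegralDeriv u' u'' :=
  ⟨intervalIntegrable_of_memLp hu.memLp, hu.deriv_eq_integral⟩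

theorem hasIntegralDeriv (hu : IsDirichletH2 u u' u'') : HasIntegralDeriv u u' :=
  ⟨ContinuousOn.intervalIntegrable (by
    rw [uIcc_of_le (by norm_num)]; exact hu.hasIntegralDeriv_deriv.continuousOn),
    hu.eq_integral_deriv⟩

end IsDirichletH2

/-! ### Solutions on the interval and eigenvalues. -/

/-- `u` solves `u'' = Q u` on `[-1, 1]`, with derivative `u'`. -/
structure IsRealLinSol (Q u u' : ℝ → ℂ) : Prop where
  hasDerivAt : ∀ x ∈ Icc (-1 : ℝ) 1, HasDerivAt u (u' x) x
  hasDerivAt_deriv : ∀ x ∈ Icc (-1 : ℝ) 1, HasDerivAt u' (Q x * u x) x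

namespace IsRealLinSol

variable {Q u u' v v' : ℝ → ℂ}

theorem continuousOn (hu : IsRealLinSol Q u u') : ContinuousOn u (Icc (-1) 1) :=
  fun x hx => (hu.hasDerivAt x hx).continuousAt.continuousWithinAt

theorem continuousOn_deriv (hu : IsRealLinSol Q u u') : ContinuousOn u' (Icc (-1) 1) :=
  fun x hx => (hu.hasDerivAt_deriv x hx).continuousAt.continuousWithinAt

theorem hasIntegralDeriv (hu : IsRealLinSol Q u u') : HasIntegralDeriv u u' :=
  .of_hasDerivAt hu.hasDerivAt hu.continuousOn_deriv

theorem hasIntegralDeriv_deriv (hQ : ContinuousOn Q (Icc (-1) 1)) (hu : IsRealLinSol Q u u') :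
    HasIntegralDeriv u' (fun x => Q x * u x) :=
  .of_hasDerivAt hu.hasDerivAt_deriv (hQ.mul hu.continuousOn)

/-- The equation has no first-order term, so the Wronskian has derivative zero. -/
theorem wronskian_eq (hu : IsRealLinSol Q u u') (hv : IsRealLinSol Q v v') {x : ℝ}
    (hx : x ∈ Icc (-1 : ℝ) 1) : u x * v' x - u' x * v x = u 1 * v' 1 - u' 1 * v 1 := by
  have hd : ∀ y ∈ Icc (-1 : ℝ) 1,
      HasDerivWithinAt (fun y => u y * v' y - u' y * v y) 0 (Icc (-1) 1) y := by
    intro y hy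
    have := ((hu.hasDerivAt y hy).mul (hv.hasDerivAt_deriv y hy)).sub
      ((hu.hasDerivAt_deriv y hy).mul (hv.hasDerivAt y hy))
    exact (this.congr_deriv (by ring)).hasDerivWithinAt
  have := (convex_Icc (-1 : ℝ) 1).norm_image_sub_le_of_norm_hasDerivWithin_le (C := 0) hd
    (by simp) hx (right_mem_Icc.2 (by norm_num))
  rw [zero_mul, norm_le_zero_iff] at this
  exact (sub_eq_zero.1 this).symm

end IsRealLinSol

/-- A bounded inverse would send `(H^h - E) u = 0` back to `u`, forcing `u = 0`. -/
theorem IsEigenvalue.mem_Sp {h : ℝ} {V : ℂ → ℂ} {E : ℂ} (hE : IsEigenvalue h V E) :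
    E ∈ Sp h V := by
  obtain ⟨u, hu, hg⟩ := hE
  rintro ⟨R, hR⟩
  exact hu (by simpa using (hR u (E • u)).1 hg)

theorem isEigenvalue_of_dirichlet {h : ℝ} (hh : 0 < h) {V : ℂ → ℂ} {E : ℂ}
    (hV : ContinuousOn (fun x : ℝ => V x) (Icc (-1) 1)) {φ φ' : ℝ → ℂ}
    (hφ : IsRealLinSol (fun x : ℝ => (V x - E) / (h : ℂ) ^ 2) φ φ')
    (hl : φ (-1) = 0) (hl' : φ' (-1) ≠ 0) (hr : φ 1 = 0) : IsEigenvalue h V E := by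
  have hh' : (h : ℂ) ≠ 0 := by exact_mod_cast hh.ne'
  have hQ : ContinuousOn (fun x : ℝ => (V x - E) / (h : ℂ) ^ 2) (Icc (-1) 1) :=
    (hV.sub continuousOn_const).div_const _
  have hm := memLp_of_continuousOn hφ.continuousOn
  have hm' : MemLp (fun x : ℝ => (V x - E) / (h : ℂ) ^ 2 * φ x) 2 μI :=
    memLp_of_continuousOn (hQ.mul hφ.continuousOn)
  refine ⟨hm.toLp, fun h0 => hl' ?_, φ, φ', _, ⟨hm',
    hφ.hasIntegralDeriv.eq, (hφ.hasIntegralDeriv_deriv hQ).eq, hl, hr⟩, hm.coeFn_toLp, ?_⟩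
  · have hae : φ =ᵐ[volume.restrict (Icc (-1) 1)] (fun _ => (0 : ℂ)) := by
      have h1 := hm.coeFn_toLp
      rw [h0] at h1
      exact h1.symm.trans (Lp.coeFn_zero _ _ _)
    -- A continuous function that vanishes almost everywhere vanishes on all of `[-1, 1]`, so its
    -- one-sided derivative at `-1` is zero too, against `hl'`.
    have hz := Measure.eqOn_Icc_of_ae_eq volume (by norm_num) hae hφ.continuousOn
      continuousOn_const
    have hd := (hφ.hasDerivAt (-1) (by norm_num)).hasDerivWithinAt (s := Icc (-1) 1)
    have hd0 : HasDerivWithinAt φ 0 (Icc (-1) 1) (-1) :=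
      (hasDerivWithinAt_const (-1 : ℝ) (Icc (-1 : ℝ) 1) (0 : ℂ)).congr hz (hz (by norm_num))
    exact (uniqueDiffOn_Icc (by norm_num : (-1 : ℝ) < 1) (-1) (by norm_num)).eq_deriv _ hd hd0
  · filter_upwards [Lp.coeFn_smul E hm.toLp, hm.coeFn_toLp] with x h1 h2
    rw [h1, Pi.smul_apply, h2, smul_eq_mul]
    field_simp
    ring

/-! ### The Green operator and the resolvent. -/

/-- The Green operator `g ↦ c (χ(x) ∫_{-1}^x φ g + φ(x) ∫_x^1 χ g)`. -/
noncomputable def greenFun (c : ℂ) (φ χ g : ℝ → ℂ) (x : ℝ) : ℂ :=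
  c * (χ x * (∫ s in (-1 : ℝ)..x, φ s * g s) +
    φ x * ((∫ s in (-1 : ℝ)..1, χ s * g s) - ∫ s in (-1 : ℝ)..x, χ s * g s))

section Green

variable {c : ℂ} {φ χ g g₁ g₂ : ℝ → ℂ}

theorem intervalIntegral_congr_of_ae (h : g₁ =ᵐ[μI] g₂) {x : ℝ} (hx : x ∈ Icc (-1 : ℝ) 1) :
    ∫ s in (-1 : ℝ)..x, φ s * g₁ s = ∫ s in (-1 : ℝ)..x, φ s * g₂ s := by
  apply intervalIntegral.integral_congr_ae
  filter_upwards [(ae_restrict_iff' measurableSet_Icc).1 h] with s hs hsx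
  rw [uIoc_of_le hx.1] at hsx
  rw [hs ⟨hsx.1.le, hsx.2.trans hx.2⟩]

theorem greenFun_congr (h : g₁ =ᵐ[μI] g₂) {x : ℝ} (hx : x ∈ Icc (-1 : ℝ) 1) :
    greenFun c φ χ g₁ x = greenFun c φ χ g₂ x := by
  simp only [greenFun]
  rw [intervalIntegral_congr_of_ae h hx, intervalIntegral_congr_of_ae h hx,
    intervalIntegral_congr_of_ae h (right_mem_Icc.2 (by norm_num))]

theorem intervalIntegrable_continuousOn_mul (hφ : ContinuousOn φ (Icc (-1) 1)) (hg : MemLp g 2 μI) :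
    IntervalIntegrable (fun s => φ s * g s) volume (-1) 1 :=
  (intervalIntegrable_of_memLp hg).continuousOn_mul (by rwa [uIcc_of_le (by norm_num)])

theorem intervalIntegrable_left (h : IntervalIntegrable g volume (-1) 1) {x : ℝ}
    (hx : x ∈ Icc (-1 : ℝ) 1) : IntervalIntegrable g volume (-1) x :=
  (HasIntegralDeriv.integral h).integrable_left hx

theorem greenFun_add (hφ : ContinuousOn φ (Icc (-1) 1)) (hχ : ContinuousOn χ (Icc (-1) 1))
    (h₁ : MemLp g₁ 2 μI) (h₂ : MemLp g₂ 2 μI) {x : ℝ} (hx : x ∈ Icc (-1 : ℝ) 1) :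
    greenFun c φ χ (g₁ + g₂) x = greenFun c φ χ g₁ x + greenFun c φ χ g₂ x := by
  have key : ∀ ψ : ℝ → ℂ, ContinuousOn ψ (Icc (-1) 1) → ∀ y ∈ Icc (-1 : ℝ) 1,
      ∫ s in (-1 : ℝ)..y, ψ s * (g₁ + g₂) s =
        (∫ s in (-1 : ℝ)..y, ψ s * g₁ s) + ∫ s in (-1 : ℝ)..y, ψ s * g₂ s := by
    intro ψ hψ y hy
    rw [← intervalIntegral.integral_add
      (intervalIntegrable_left (intervalIntegrable_continuousOn_mul hψ h₁) hy)
      (intervalIntegrable_left (intervalIntegrable_continuousOn_mul hψ h₂) hy)]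
    simp [mul_add]
  simp only [greenFun]
  rw [key φ hφ x hx, key χ hχ x hx, key χ hχ 1 (right_mem_Icc.2 (by norm_num))]
  ring

theorem greenFun_smul (a : ℂ) (x : ℝ) :
    greenFun c φ χ (a • g) x = a * greenFun c φ χ g x := by
  have key : ∀ (ψ : ℝ → ℂ) (y : ℝ), ∫ s in (-1 : ℝ)..y, ψ s * (a • g) s =
      a * ∫ s in (-1 : ℝ)..y, ψ s * g s := by
    intro ψ y
    rw [← intervalIntegral.integral_const_mul]
    simp [mul_left_comm]
  simp only [greenFun, key]
  ring

/-- Hölder on an interval of length `2`; it turns the sup bound on the Green function into an `L²`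
operator bound. -/
theorem integral_norm_le_of_memLp (f : L2I) :
    ∫ s in (-1 : ℝ)..1, ‖f s‖ ≤ 2 ^ (1 / 2 : ℝ) * ‖f‖ := by
  have hf := Lp.memLp f
  have h1 := eLpNorm_le_eLpNorm_mul_rpow_measure_univ (p := 1) (q := 2) one_le_two hf.1
  have hv : μI univ = 2 := by
    rw [Measure.restrict_apply_univ, Real.volume_Icc]; norm_num
  rw [hv] at h1
  have h2 : ∫ s in (-1 : ℝ)..1, ‖f s‖ = (eLpNorm f 1 μI).toReal := by
    rw [intervalIntegral.integral_of_le (by norm_num), ← integral_Icc_eq_integral_Ioc,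
      integral_norm_eq_lintegral_enorm hf.1, eLpNorm_one_eq_lintegral_enorm]
  rw [h2, Lp.norm_def, mul_comm]
  refine (ENNReal.toReal_mono ?_ h1).trans_eq ?_
  · exact ENNReal.mul_ne_top hf.2.ne (by norm_num)
  · rw [ENNReal.toReal_mul, ← ENNReal.toReal_rpow]
    norm_num

theorem exists_bound_greenFun (c : ℂ) (hφ : ContinuousOn φ (Icc (-1) 1))
    (hχ : ContinuousOn χ (Icc (-1) 1)) :
    ∃ C : ℝ, 0 ≤ C ∧ ∀ (f : L2I), ∀ x ∈ Icc (-1 : ℝ) 1, ‖greenFun c φ χ f x‖ ≤ C * ‖f‖ := by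
  obtain ⟨A, hA⟩ := isCompact_Icc.exists_bound_of_continuousOn hφ
  obtain ⟨B, hB⟩ := isCompact_Icc.exists_bound_of_continuousOn hχ
  have hA0 : 0 ≤ A := (norm_nonneg _).trans (hA 0 (by norm_num))
  have hB0 : 0 ≤ B := (norm_nonneg _).trans (hB 0 (by norm_num))
  refine ⟨‖c‖ * (3 * (A * B)) * 2 ^ (1 / 2 : ℝ), by positivity, fun f x hx => ?_⟩
  set J := ∫ s in (-1 : ℝ)..1, ‖f s‖ with hJ
  have hint : IntervalIntegrable (fun s => ‖f s‖) volume (-1) 1 :=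
    (intervalIntegrable_of_memLp (Lp.memLp f)).norm
  have key : ∀ (ψ : ℝ → ℂ) (M : ℝ), (∀ x ∈ Icc (-1 : ℝ) 1, ‖ψ x‖ ≤ M) → ∀ y ∈ Icc (-1 : ℝ) 1,
      ‖∫ s in (-1 : ℝ)..y, ψ s * f s‖ ≤ M * J := by
    intro ψ M hM y hy
    have hM0 : 0 ≤ M := (norm_nonneg _).trans (hM 0 (by norm_num))
    calc ‖∫ s in (-1 : ℝ)..y, ψ s * f s‖ ≤ ∫ s in (-1 : ℝ)..y, M * ‖f s‖ := by
          refine intervalIntegral.norm_integral_le_of_norm_le hy.1 (ae_of_all _ fun s hs => ?_)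
            ((hint.mono_set (by
              rw [uIcc_of_le hy.1, uIcc_of_le (by norm_num)]
              exact Icc_subset_Icc le_rfl hy.2)).const_mul M)
          rw [norm_mul]
          exact mul_le_mul_of_nonneg_right (hM s ⟨hs.1.le, hs.2.trans hy.2⟩) (norm_nonneg _)
      _ ≤ ∫ s in (-1 : ℝ)..1, M * ‖f s‖ :=
          intervalIntegral.integral_mono_interval le_rfl hy.1 hy.2
            (ae_of_all _ fun s => by positivity) (hint.const_mul M)
      _ = M * J := intervalIntegral.integral_const_mul _ _
  have k1 := key φ A hA x hx
  have k2 := key χ B hB x hx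
  have k3 := key χ B hB 1 (right_mem_Icc.2 (by norm_num))
  have hJ0 : 0 ≤ J := intervalIntegral.integral_nonneg (by norm_num) fun _ _ => norm_nonneg _
  calc ‖greenFun c φ χ f x‖
      ≤ ‖c‖ * (B * (A * J) + A * (B * J + B * J)) := by
        rw [greenFun, norm_mul]
        refine mul_le_mul_of_nonneg_left ((norm_add_le _ _).trans ?_) (norm_nonneg _)
        rw [norm_mul, norm_mul]
        refine add_le_add (mul_le_mul (hB x hx) k1 (norm_nonneg _) hB0)
          (mul_le_mul (hA x hx) ((norm_sub_le _ _).trans (add_le_add k3 k2)) (norm_nonneg _) hA0)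
    _ = ‖c‖ * (3 * (A * B)) * J := by ring
    _ ≤ ‖c‖ * (3 * (A * B)) * (2 ^ (1 / 2 : ℝ) * ‖f‖) := by
        gcongr; exact integral_norm_le_of_memLp f
    _ = _ := by ring

theorem continuousOn_greenFun (hφ : ContinuousOn φ (Icc (-1) 1))
    (hχ : ContinuousOn χ (Icc (-1) 1)) (hg : MemLp g 2 μI) :
    ContinuousOn (greenFun c φ χ g) (Icc (-1) 1) := by
  have h1 := (HasIntegralDeriv.integral (intervalIntegrable_continuousOn_mul hφ hg)).continuousOn
  have h2 := (HasIntegralDeriv.integral (intervalIntegrable_continuousOn_mul hχ hg)).continuousOn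
  exact continuousOn_const.mul ((hχ.mul h1).add (hφ.mul (continuousOn_const.sub h2)))

/-- The Green operator as a bounded operator on `L²`. -/
theorem exists_greenOp (c : ℂ) (hφ : ContinuousOn φ (Icc (-1) 1))
    (hχ : ContinuousOn χ (Icc (-1) 1)) :
    ∃ R : L2I →L[ℂ] L2I, ∀ f : L2I, R f =ᵐ[μI] greenFun c φ χ f := by
  obtain ⟨C, hC0, hC⟩ := exists_bound_greenFun c hφ hχ
  have hm : ∀ f : L2I, MemLp (greenFun c φ χ f) 2 μI := fun f =>
    memLp_of_continuousOn (continuousOn_greenFun hφ hχ (Lp.memLp f))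
  have hI : ∀ᵐ x ∂μI, x ∈ Icc (-1 : ℝ) 1 := ae_restrict_mem measurableSet_Icc
  let T : L2I →ₗ[ℂ] L2I :=
    { toFun := fun f => (hm f).toLp
      map_add' := fun f g => by
        apply Lp.ext
        filter_upwards [(hm (f + g)).coeFn_toLp, Lp.coeFn_add (hm f).toLp (hm g).toLp,
          (hm f).coeFn_toLp, (hm g).coeFn_toLp, hI] with x h1 h2 h3 h4 hx
        rw [h1, h2, Pi.add_apply, h3, h4, greenFun_congr (Lp.coeFn_add f g) hx,
          greenFun_add hφ hχ (Lp.memLp f) (Lp.memLp g) hx]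
      map_smul' := fun a f => by
        apply Lp.ext
        filter_upwards [(hm (a • f)).coeFn_toLp, Lp.coeFn_smul a (hm f).toLp,
          (hm f).coeFn_toLp, hI] with x h1 h2 h3 hx
        rw [h1, RingHom.id_apply, h2, Pi.smul_apply, h3, greenFun_congr (Lp.coeFn_smul a f) hx,
          greenFun_smul, smul_eq_mul] }
  refine ⟨T.mkContinuous ((μI univ).toReal ^ (2 : ENNReal).toReal⁻¹ * C) fun f => ?_,
    fun f => (hm f).coeFn_toLp⟩
  have := Lp.norm_le_of_ae_bound (f := T f) (C := C * ‖f‖) (by positivity) (by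
    filter_upwards [(hm f).coeFn_toLp, hI] with x h1 hx
    rw [show T f = (hm f).toLp from rfl, h1]
    exact hC f x hx)
  rw [mul_assoc]
  exact this

variable {h : ℝ} {V : ℂ → ℂ} {E : ℂ} {φ' χ' : ℝ → ℂ}

/-- The Green function inverts `H^h - E`. -/
theorem isDirichletH2_greenFun
    {Q : ℝ → ℂ} (hQ : ContinuousOn Q (Icc (-1) 1)) (hφ : IsRealLinSol Q φ φ')
    (hχ : IsRealLinSol Q χ χ') (hl : φ (-1) = 0) (hr : χ 1 = 0) (hr' : χ' 1 = 1)
    (hg : MemLp g 2 μI) :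
    ∃ U' : ℝ → ℂ, IsDirichletH2 (greenFun c φ χ g) U'
      (fun x => Q x * greenFun c φ χ g x + c * (φ x * χ' x - φ' x * χ x) * g x) := by
  have Iφ := HasIntegralDeriv.integral
    (intervalIntegrable_continuousOn_mul hφ.continuousOn hg)
  have Iχ := ((HasIntegralDeriv.integral
    (intervalIntegrable_continuousOn_mul hχ.continuousOn hg)).const_mul (-1)).add
    (HasIntegralDeriv.const (∫ s in (-1 : ℝ)..1, χ s * g s))
  have hU := ((hχ.hasIntegralDeriv.mul Iφ).add (hφ.hasIntegralDeriv.mul Iχ)).const_mul c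
  have hU' := (((hχ.hasIntegralDeriv_deriv hQ).mul Iφ).add
    ((hφ.hasIntegralDeriv_deriv hQ).mul Iχ)).const_mul c
  have h0 := hU.congr (A' := greenFun c φ χ g) (α' := fun x => c *
    (χ' x * (∫ s in (-1 : ℝ)..x, φ s * g s) +
      φ' x * (-1 * (∫ s in (-1 : ℝ)..x, χ s * g s) + ∫ s in (-1 : ℝ)..1, χ s * g s)))
    (fun x => by simp only [greenFun]; ring) (fun x => by ring)
  have h1 := hU'.congr (A' := fun x => c *
    (χ' x * (∫ s in (-1 : ℝ)..x, φ s * g s) +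
      φ' x * (-1 * (∫ s in (-1 : ℝ)..x, χ s * g s) + ∫ s in (-1 : ℝ)..1, χ s * g s)))
    (α' := fun x => Q x * greenFun c φ χ g x + c * (φ x * χ' x - φ' x * χ x) * g x)
    (fun x => by ring) (fun x => by simp only [greenFun]; ring)
  -- The coefficient of `g` is `c` times a Wronskian, which is constant and is read off at `1`.
  have hW : ∀ x ∈ Icc (-1 : ℝ) 1, c * (φ x * χ' x - φ' x * χ x) * g x = c * φ 1 * g x := by
    intro x hx
    rw [hφ.wronskian_eq hχ hx, hr, hr']; ring
  refine ⟨_, ⟨?_, h0.eq, h1.eq, ?_, ?_⟩⟩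
  · have hm : MemLp (fun x => Q x * greenFun c φ χ g x + c * φ 1 * g x) 2 μI :=
      (memLp_of_continuousOn (hQ.mul (continuousOn_greenFun hφ.continuousOn
        hχ.continuousOn hg))).add (hg.const_mul (c * φ 1))
    refine (memLp_congr_ae ?_).1 hm
    filter_upwards [ae_restrict_mem measurableSet_Icc] with x hx
    rw [hW x hx]
  · simp [greenFun, hl]
  · simp [greenFun, hr]

/-- Lagrange's identity `ψ (U'' - Q U) = (ψ U' - ψ' U)'` integrates both terms of the Green
operator. The boundary terms cancel or vanish, leaving the Wronskian times `U x`. -/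
theorem eq_greenFun_of_isDirichletH2
    {Q : ℝ → ℂ} (hQ : ContinuousOn Q (Icc (-1) 1)) (hφ : IsRealLinSol Q φ φ')
    (hχ : IsRealLinSol Q χ χ') (hl : φ (-1) = 0) (hr : χ 1 = 0) (hr' : χ' 1 = 1)
    {U U' U'' : ℝ → ℂ} (hU : IsDirichletH2 U U' U'') {x : ℝ} (hx : x ∈ Icc (-1 : ℝ) 1) :
    greenFun c φ χ (fun x => U'' x - Q x * U x) x = c * φ 1 * U x := by
  have key : ∀ ψ ψ' : ℝ → ℂ, IsRealLinSol Q ψ ψ' → ∀ y ∈ Icc (-1 : ℝ) 1,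
      ∫ s in (-1 : ℝ)..y, ψ s * (U'' s - Q s * U s) =
        ψ y * U' y - ψ' y * U y - (ψ (-1) * U' (-1) - ψ' (-1) * U (-1)) := by
    intro ψ ψ' hψ y hy
    have h1 := (hψ.hasIntegralDeriv.mul hU.hasIntegralDeriv_deriv).add
      (((hψ.hasIntegralDeriv_deriv hQ).mul hU.hasIntegralDeriv).const_mul (-1))
    have h2 := h1.eq y hy
    have h3 : (∫ s in (-1 : ℝ)..y, ψ s * (U'' s - Q s * U s)) =
      ∫ s in (-1 : ℝ)..y, (ψ' s * U' s + ψ s * U'' s) +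
        -1 * (Q s * ψ s * U s + ψ' s * U' s) :=
      intervalIntegral.integral_congr fun s _ => by ring
    rw [h3]
    linear_combination -h2
  have hW := hφ.wronskian_eq hχ hx
  simp only [greenFun]
  rw [key φ φ' hφ x hx, key χ χ' hχ x hx, key χ χ' hχ 1 (right_mem_Icc.2 (by norm_num)), hl, hr,
    hU.left, hU.right]
  rw [hr, hr'] at hW
  linear_combination c * U x * hW

theorem not_mem_Sp_of_dirichlet (hh : 0 < h)
    (hV : ContinuousOn (fun x : ℝ => V x) (Icc (-1) 1))
    (hφ : IsRealLinSol (fun x : ℝ => (V x - E) / (h : ℂ) ^ 2) φ φ')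
    (hχ : IsRealLinSol (fun x : ℝ => (V x - E) / (h : ℂ) ^ 2) χ χ')
    (hl : φ (-1) = 0) (hr : χ 1 = 0) (hr' : χ' 1 = 1) (hφ1 : φ 1 ≠ 0) : E ∉ Sp h V := by
  have hh' : (h : ℂ) ≠ 0 := by exact_mod_cast hh.ne'
  have hQ : ContinuousOn (fun x : ℝ => (V x - E) / (h : ℂ) ^ 2) (Icc (-1) 1) :=
    (hV.sub continuousOn_const).div_const _
  -- By the Wronskian, `H^h - E` maps the Green integral of `g` to `-h² c φ(1) g`; this `c` makes
  -- that `g`.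
  set c : ℂ := -1 / ((h : ℂ) ^ 2 * φ 1) with hc
  obtain ⟨R, hR⟩ := exists_greenOp c hφ.continuousOn hχ.continuousOn
  have hI : ∀ᵐ x ∂μI, x ∈ Icc (-1 : ℝ) 1 := ae_restrict_mem measurableSet_Icc
  refine not_not.2 ⟨R, fun u f => ⟨?_, ?_⟩⟩
  · rintro ⟨U, U', U'', hU, hu, hf⟩
    apply Lp.ext
    have hg : (f - E • u : L2I) =ᵐ[μI]
        (-(h : ℂ) ^ 2) • fun x => U'' x - (V x - E) / (h : ℂ) ^ 2 * U x := by
      filter_upwards [Lp.coeFn_sub f (E • u), Lp.coeFn_smul E u, hu, hf] with x h1 h2 h3 h4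
      rw [h1, Pi.sub_apply, h2, Pi.smul_apply, h3, h4, Pi.smul_apply, smul_eq_mul, smul_eq_mul]
      field_simp
      ring
    filter_upwards [hu, hR (f - E • u), hI] with x h1 h2 hx
    rw [h1, h2, greenFun_congr hg hx, greenFun_smul,
      eq_greenFun_of_isDirichletH2 hQ hφ hχ hl hr hr' hU hx, hc]
    field_simp
  · intro hu
    obtain ⟨U', hU⟩ := isDirichletH2_greenFun (c := c) hQ hφ hχ hl hr hr' (Lp.memLp (f - E • u))
    have hu' : u =ᵐ[μI] greenFun c φ χ (f - E • u : L2I) := by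
      have := hR (f - E • u)
      rwa [← hu] at this
    refine ⟨_, _, _, hU, hu', ?_⟩
    filter_upwards [hu', Lp.coeFn_sub f (E • u), Lp.coeFn_smul E u, hI] with x h1 h2 h3 hx
    have h4 : f x = (f - E • u : L2I) x + E * u x := by
      rw [h2, Pi.sub_apply, h3, Pi.smul_apply, smul_eq_mul]; ring
    rw [h4, hφ.wronskian_eq hχ hx, hr, hr', ← h1, hc]
    field_simp
    ring

end Green

/-! ### The perturbed oscillator. -/

theorem Complex.norm_sin_le_exp_abs_im (z : ℂ) : ‖Complex.sin z‖ ≤ Real.exp |z.im| := by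
  have h1 : ‖Complex.exp (-z * I)‖ ≤ Real.exp |z.im| := by
    rw [Complex.norm_exp]; simpa using le_abs_self z.im
  have h2 : ‖Complex.exp (z * I)‖ ≤ Real.exp |z.im| := by
    rw [Complex.norm_exp]; simpa using neg_le_abs z.im
  rw [Complex.sin, norm_div, norm_mul, Complex.norm_I, mul_one, Complex.norm_two]
  have := norm_sub_le (Complex.exp (-z * I)) (Complex.exp (z * I))
  linarith

/-- One of `e^{± i z}` has norm `e^{|Im z|}` and the other has norm at most `1`. -/
theorem Complex.exp_abs_im_sub_one_le_norm_sin (z : ℂ) :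
    (Real.exp |z.im| - 1) / 2 ≤ ‖Complex.sin z‖ := by
  have key : ∀ a b : ℂ, a * b = 1 → 1 ≤ ‖a‖ → (‖a‖ - 1) / 2 ≤ ‖(a - b) / 2‖ := by
    intro a b hab ha
    have hb : ‖b‖ ≤ 1 := by
      have : ‖a‖ * ‖b‖ = 1 := by rw [← norm_mul, hab, norm_one]
      nlinarith [norm_nonneg b]
    rw [norm_div, Complex.norm_two]
    have := norm_sub_norm_le a b
    linarith
  have hn : ‖Complex.sin z‖ = ‖(Complex.exp (-z * I) - Complex.exp (z * I)) / 2‖ := by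
    simp [Complex.sin]
  have h1 : ‖Complex.exp (-z * I)‖ = Real.exp z.im := by
    rw [Complex.norm_exp]; simp
  have h2 : ‖Complex.exp (z * I)‖ = Real.exp (-z.im) := by
    rw [Complex.norm_exp]; simp
  rw [hn]
  rcases le_total 0 z.im with h | h
  · have := key (Complex.exp (-z * I)) (Complex.exp (z * I)) (by rw [← Complex.exp_add]; simp)
      (by rw [h1]; exact Real.one_le_exp h)
    rwa [h1, ← abs_of_nonneg h] at this
  · have := key (Complex.exp (z * I)) (Complex.exp (-z * I)) (by rw [← Complex.exp_add]; simp)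
      (by rw [h2]; exact Real.one_le_exp (by linarith))
    rw [h2, ← abs_of_nonpos h] at this
    rwa [← neg_sub (Complex.exp (z * I)), neg_div, norm_neg]

/-- If `w' = Z v` and `v' = Z (-1/h² + b) w` on `[0, 1]` with `w(0) = 0`, then `w(1)` is close to
`h v(0) sin (Z/h)`. -/
theorem norm_sub_sin_le_of_perturbed_oscillator {Z : ℂ} {h B : ℝ} (hh : 0 < h) {w v b : ℝ → ℂ}
    (hw : ∀ t ∈ Icc (0 : ℝ) 1, HasDerivAt w (Z * v t) t)
    (hv : ∀ t ∈ Icc (0 : ℝ) 1, HasDerivAt v (Z * (-1 / (h : ℂ) ^ 2 + b t) * w t) t)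
    (hb : ∀ t ∈ Icc (0 : ℝ) 1, ‖b t‖ ≤ B) (h0 : w 0 = 0) (hs : h * ‖Z‖ * B ≤ 1 / 2) :
    ‖w 1 - h * v 0 * Complex.sin (Z / h)‖ ≤
      2 * h ^ 2 * ‖Z‖ * B * ‖v 0‖ * Real.exp (|Z.im| / h) := by
  have hh' : (h : ℂ) ≠ 0 := by exact_mod_cast hh.ne'
  have hB0 : 0 ≤ B := (norm_nonneg _).trans (hb 0 (by norm_num))
  set σ : ℝ := |Z.im| / h with hσ
  have hσ0 : 0 ≤ σ := by positivity
  have hsin : ∀ t : ℝ, 0 ≤ t → ‖Complex.sin (Z * t / h)‖ ≤ Real.exp (σ * t) := by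
    intro t ht
    refine (Complex.norm_sin_le_exp_abs_im _).trans_eq ?_
    have : (Z * t / h).im = Z.im * t / h := by
      rw [Complex.div_ofReal_im, Complex.im_mul_ofReal]
    rw [this, abs_div, abs_mul, abs_of_nonneg ht, abs_of_pos hh, hσ]
    ring_nf
  have hcw : ContinuousOn (fun t => Real.exp (-(σ * t)) * ‖w t‖) (Icc 0 1) :=
    (by fun_prop : Continuous fun t : ℝ => Real.exp (-(σ * t))).continuousOn.mul
      (fun t ht => (hw t ht).continuousAt.norm.continuousWithinAt)
  obtain ⟨t₀, ht₀, hmax⟩ := isCompact_Icc.exists_isMaxOn (nonempty_Icc.2 zero_le_one) hcw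
  -- `m` is the norm of `w` weighted by the growth rate `σ` of the free oscillator. It is bounded
  -- below by feeding Duhamel's formula into itself.
  set m := Real.exp (-(σ * t₀)) * ‖w t₀‖ with hm
  have hm0 : 0 ≤ m := by positivity
  have hwm : ∀ t ∈ Icc (0 : ℝ) 1, ‖w t‖ ≤ m * Real.exp (σ * t) := by
    intro t ht
    have h1 : Real.exp (-(σ * t)) * ‖w t‖ ≤ m := hmax ht
    rw [Real.exp_neg, inv_mul_le_iff₀ (Real.exp_pos _)] at h1
    linarith
  have duhamel : ∀ t ∈ Icc (0 : ℝ) 1, ‖w t - h * v 0 * Complex.sin (Z * t / h)‖ ≤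
      h * ‖Z‖ * B * m * Real.exp (σ * t) := by
    intro t ht
    -- `g s` is the value at time `t` of the free solution that agrees with `(w, v)` at time `s`. It
    -- interpolates between the free solution at `s = 0` and `w t` at `s = t`, and only `b`
    -- contributes to its derivative.
    set g : ℝ → ℂ := fun s => h * v s * Complex.sin (Z * ((t - s : ℝ) : ℂ) / h) +
      w s * Complex.cos (Z * ((t - s : ℝ) : ℂ) / h) with hg
    have hd : ∀ s ∈ Icc (0 : ℝ) t, HasDerivWithinAt g
        (h * Z * b s * w s * Complex.sin (Z * ((t - s : ℝ) : ℂ) / h)) (Icc 0 t) s := by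
      intro s hs
      have hs1 : s ∈ Icc (0 : ℝ) 1 := ⟨hs.1, hs.2.trans ht.2⟩
      have ha : HasDerivAt (fun s : ℝ => Z * ((t - s : ℝ) : ℂ) / h) (-Z / h) s := by
        have h1 : HasDerivAt (fun s : ℝ => ((t - s : ℝ) : ℂ)) (-1) s := by
          simpa using ((hasDerivAt_id s).const_sub t).ofReal_comp
        simpa using (h1.const_mul Z).div_const (h : ℂ)
      have h2 := (((hv s hs1).const_mul (h : ℂ)).mul
        ((Complex.hasDerivAt_sin _).comp s ha)).add
        ((hw s hs1).mul ((Complex.hasDerivAt_cos _).comp s ha))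
      refine (h2.congr_deriv ?_).hasDerivWithinAt
      simp only [Function.comp]
      field_simp
      ring
    have hbd : ∀ s ∈ Icc (0 : ℝ) t,
        ‖h * Z * b s * w s * Complex.sin (Z * ((t - s : ℝ) : ℂ) / h)‖ ≤
          h * ‖Z‖ * B * m * Real.exp (σ * t) := by
      intro s hs
      have hs1 : s ∈ Icc (0 : ℝ) 1 := ⟨hs.1, hs.2.trans ht.2⟩
      have e1 := hb s hs1
      have e2 := hwm s hs1
      have e3 := hsin (t - s) (by linarith [hs.2])
      calc ‖h * Z * b s * w s * Complex.sin (Z * ((t - s : ℝ) : ℂ) / h)‖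
          = h * ‖Z‖ * ‖b s‖ * ‖w s‖ * ‖Complex.sin (Z * ((t - s : ℝ) : ℂ) / h)‖ := by
            simp only [norm_mul, Complex.norm_real, Real.norm_eq_abs, abs_of_pos hh]
        _ ≤ h * ‖Z‖ * B * (m * Real.exp (σ * s)) * Real.exp (σ * (t - s)) := by gcongr
        _ = h * ‖Z‖ * B * m * (Real.exp (σ * s) * Real.exp (σ * (t - s))) := by ring
        -- The two exponentials combine to exactly `exp (σ t)`: on a straight segment nothing is
        -- lost.
        _ = _ := by rw [← Real.exp_add]; ring_nf
    have hfin := (convex_Icc (0 : ℝ) t).norm_image_sub_le_of_norm_hasDerivWithin_le hd hbd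
      (left_mem_Icc.2 ht.1) (right_mem_Icc.2 ht.1)
    have e1 : g t = w t := by simp [hg]
    have e2 : g 0 = h * v 0 * Complex.sin (Z * t / h) := by simp [hg, h0]
    rw [e1, e2, sub_zero, Real.norm_of_nonneg ht.1] at hfin
    exact hfin.trans (mul_le_of_le_one_right (by positivity) ht.2)
  have hm2 : m ≤ 2 * h * ‖v 0‖ := by
    have h1 := duhamel t₀ ht₀
    have h2 : ‖w t₀‖ ≤ h * ‖v 0‖ * Real.exp (σ * t₀) + h * ‖Z‖ * B * m * Real.exp (σ * t₀) := by
      have h3 := norm_le_norm_add_norm_sub' (w t₀) (h * v 0 * Complex.sin (Z * t₀ / h))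
      have h4 : ‖h * v 0 * Complex.sin (Z * t₀ / h)‖ ≤ h * ‖v 0‖ * Real.exp (σ * t₀) := by
        rw [norm_mul, norm_mul, Complex.norm_real, Real.norm_of_nonneg hh.le]
        exact mul_le_mul_of_nonneg_left (hsin t₀ ht₀.1) (by positivity)
      linarith
    -- Evaluated at the maximum point, Duhamel bounds `m` by itself with a factor at most `1/2`,
    -- which is absorbed.
    have h5 : m ≤ h * ‖v 0‖ + h * ‖Z‖ * B * m := by
      have h7 : m * Real.exp (σ * t₀) = ‖w t₀‖ := by
        rw [hm, mul_right_comm, ← Real.exp_add, neg_add_cancel, Real.exp_zero, one_mul]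
      refine le_of_mul_le_mul_right ?_ (Real.exp_pos (σ * t₀))
      rw [h7, add_mul]
      exact h2
    have h6 := mul_le_mul_of_nonneg_right hs hm0
    linarith
  have := duhamel 1 (by norm_num)
  rw [Complex.ofReal_one, mul_one, mul_one] at this
  refine this.trans ?_
  calc h * ‖Z‖ * B * m * Real.exp σ ≤ h * ‖Z‖ * B * (2 * h * ‖v 0‖) * Real.exp σ := by gcongr
    _ = _ := by ring

/-! ### Deformation of the path of integration. -/

/-- If `q` is close to `1` near `[-1, 1]` and `ζ` is its primitive vanishing at `-1`, then there is
a curve from `-1` to `1` mapped by `ζ` to the segment from `0` to `ζ(1)`. -/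
theorem exists_curve_to_segment {N : Set ℂ} (hN : Convex ℝ N) (hNo : IsOpen N) {δ η : ℝ}
    (hδ : ∀ x ∈ Icc (-1 : ℝ) 1, Metric.closedBall (x : ℂ) δ ⊆ N) (hδ0 : 0 < δ) (hη0 : 0 ≤ η)
    (hη1 : η < 1) (hηδ : 4 * η ≤ (1 - η) * δ) {q ζ : ℂ → ℂ} (hq : ∀ z ∈ N, ‖q z - 1‖ ≤ η)
    (hζ : ∀ z ∈ N, HasDerivAt ζ (q z) z) (hζ0 : ζ (-1) = 0) :
    ∃ γ : ℝ → ℂ, γ 0 = -1 ∧ γ 1 = 1 ∧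
      ∀ t ∈ Icc (0 : ℝ) 1, γ t ∈ N ∧ HasDerivAt γ (ζ 1 / q (γ t)) t := by
  have hmem : ∀ x ∈ Icc (-1 : ℝ) 1, (x : ℂ) ∈ N := fun x hx =>
    hδ x hx (Metric.mem_closedBall_self hδ0.le)
  have hq0 : ∀ z ∈ N, q z ≠ 0 := by
    intro z hz h
    have := hq z hz
    rw [h] at this
    norm_num at this
    linarith
  lift η to NNReal using hη0
  -- `ζ - id` is `η`-Lipschitz on the convex set `N`, so `ζ` is invertible there and covers balls of
  -- quantified radius.
  have happ : ApproximatesLinearOn ζ ((ContinuousLinearEquiv.refl ℂ ℂ : ℂ ≃L[ℂ] ℂ) : ℂ →L[ℂ] ℂ)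
      N η := by
    intro x hx y hy
    have := hN.norm_image_sub_le_of_norm_hasDerivWithin_le (f := fun z => ζ z - z)
      (f' := fun z => q z - 1) (C := η)
      (fun z hz => ((hζ z hz).sub (hasDerivAt_id z)).hasDerivWithinAt) hq hy hx
    have e : ζ x - ζ y - (ContinuousLinearEquiv.refl ℂ ℂ : ℂ →L[ℂ] ℂ) (x - y) =
        ζ x - x - (ζ y - y) := by
      simp; ring
    rw [e]; exact this
  have hnorm : ‖((ContinuousLinearEquiv.refl ℂ ℂ).symm : ℂ →L[ℂ] ℂ)‖₊ = 1 := by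
    ext; simp
  have hc : Subsingleton ℂ ∨ η < ‖((ContinuousLinearEquiv.refl ℂ ℂ).symm : ℂ →L[ℂ] ℂ)‖₊⁻¹ := by
    right; rw [hnorm, inv_one]; exact_mod_cast hη1
  set e := happ.toOpenPartialHomeomorph ζ N hc hNo with he
  have hm1 : (-1 : ℂ) ∈ N := by simpa using hmem (-1) (by norm_num)
  have hp1 : (1 : ℂ) ∈ N := by simpa using hmem 1 (by norm_num)
  have hest : ∀ x ∈ N, ‖ζ x - (x + 1)‖ ≤ η * ‖x + 1‖ := by
    intro x hx
    have := happ x hx (-1) hm1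
    simpa [hζ0] using this
  -- `t ζ(1)` and `ζ(-1 + 2t)` are both within `2η` of `2t`, hence within `4η` of each other, and
  -- the image of `ζ` contains the ball of radius `(1 - η) δ` around the latter.
  have htarget : ∀ t ∈ Icc (0 : ℝ) 1, (t : ℂ) * ζ 1 ∈ e.target := by
    intro t ht
    have hx : (-1 + 2 * t : ℝ) ∈ Icc (-1 : ℝ) 1 := ⟨by linarith [ht.1], by linarith [ht.2]⟩
    refine happ.closedBall_subset_target hc hNo hδ0.le (hδ _ hx) ?_
    rw [hnorm, mem_closedBall_iff_norm]
    have h1 := hest _ (hmem _ hx)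
    have h2 := hest 1 hp1
    have e1 : (((-1 + 2 * t : ℝ) : ℂ) + 1) = ((2 * t : ℝ) : ℂ) := by push_cast; ring
    have e2 : ‖((2 * t : ℝ) : ℂ)‖ = 2 * t := by
      rw [Complex.norm_real, Real.norm_of_nonneg (by linarith [ht.1])]
    rw [e1, e2] at h1
    have e3 : ‖(1 + 1 : ℂ)‖ = 2 := by norm_num
    rw [e3] at h2
    have e4 : (t : ℂ) * ζ 1 - ζ ((-1 + 2 * t : ℝ) : ℂ) = t * (ζ 1 - (1 + 1)) -
        (ζ ((-1 + 2 * t : ℝ) : ℂ) - ((2 * t : ℝ) : ℂ)) := by push_cast; ring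
    rw [e4]
    refine (norm_sub_le _ _).trans ?_
    rw [norm_mul, Complex.norm_real, Real.norm_of_nonneg ht.1]
    have h3 := mul_le_mul ht.2 h2 (norm_nonneg _) zero_le_one
    have h4 : (η : ℝ) * (2 * t) ≤ η * 2 := by
      have := ht.2
      gcongr; linarith
    rw [inv_one, NNReal.coe_one]
    linarith
  refine ⟨fun t => e.symm (t * ζ 1), ?_, ?_, fun t ht => ?_⟩
  · have : e.symm (ζ (-1)) = -1 := e.left_inv hm1
    simpa [hζ0] using this
  · have : e.symm (ζ 1) = 1 := e.left_inv hp1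
    simpa using this
  · have hm : e.symm (t * ζ 1) ∈ N := e.map_target (htarget t ht)
    have hd := e.hasDerivAt_symm (htarget t ht) (hq0 _ hm) (hζ _ hm)
    refine ⟨hm, ?_⟩
    have h1 : HasDerivAt (fun t : ℝ => (t : ℂ) * ζ 1) (ζ 1) t := by
      simpa using (Complex.ofRealCLM.hasDerivAt (x := t)).mul_const (ζ 1)
    have := hd.comp t h1
    refine this.congr_deriv ?_
    ring

/-! ### Holomorphic dependence on the energy. -/

/-- The value at `1` of the solution of `-h² u'' + (V - E) u = 0`, `u(-1) = 0`, `u'(-1) = 1`, is an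
entire function of `E`. -/
theorem differentiable_shooting {h : ℝ} (hh : 0 < h) {V : ℂ → ℂ}
    (hV : ContinuousOn (fun x : ℝ => V x) (Icc (-1) 1)) {φ φ' χ χ' : ℂ → ℝ → ℂ}
    (hφ : ∀ E, IsRealLinSol (fun x : ℝ => (V x - E) / (h : ℂ) ^ 2) (φ E) (φ' E))
    (hχ : ∀ E, IsRealLinSol (fun x : ℝ => (V x - E) / (h : ℂ) ^ 2) (χ E) (χ' E))
    (hl : ∀ E, φ E (-1) = 0) (hl' : ∀ E, φ' E (-1) = 1)
    (hr : ∀ E, χ E 1 = 0) (hr' : ∀ E, χ' E 1 = 1) : Differentiable ℂ fun E => φ E 1 := by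
  have hh' : (h : ℂ) ≠ 0 := by exact_mod_cast hh.ne'
  have hI : uIcc (-1 : ℝ) 1 = Icc (-1) 1 := uIcc_of_le (by norm_num)
  -- Green's identity for solutions at two energies. Subtracting the case `E' = E` gives the
  -- difference quotient of `φ E 1` as an integral, so only uniform convergence of `φ E'` to `φ E`
  -- is needed.
  have wr : ∀ E E', φ E' 1 + χ E (-1) =
      (E' - E) / (h : ℂ) ^ 2 * ∫ x in (-1 : ℝ)..1, φ E' x * χ E x := by
    intro E E'
    have hc : ContinuousOn (fun x => (E' - E) / (h : ℂ) ^ 2 * (φ E' x * χ E x)) (Icc (-1) 1) :=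
      continuousOn_const.mul ((hφ E').continuousOn.mul (hχ E).continuousOn)
    have := intervalIntegral.integral_eq_sub_of_hasDerivAt (a := -1) (b := 1)
      (f := fun x => φ E' x * χ' E x - φ' E' x * χ E x)
      (f' := fun x => (E' - E) / (h : ℂ) ^ 2 * (φ E' x * χ E x)) (fun x hx => by
        rw [hI] at hx
        refine ((((hφ E').hasDerivAt x hx).mul ((hχ E).hasDerivAt_deriv x hx)).sub
          (((hφ E').hasDerivAt_deriv x hx).mul ((hχ E).hasDerivAt x hx))).congr_deriv ?_
        ring) (ContinuousOn.intervalIntegrable (by rwa [hI]))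
    rw [intervalIntegral.integral_const_mul] at this
    rw [this, hr, hr', hl, hl']
    ring
  intro E
  obtain ⟨A, hA⟩ := isCompact_Icc.exists_bound_of_continuousOn (hφ E).continuousOn
  obtain ⟨B, hB⟩ := isCompact_Icc.exists_bound_of_continuousOn (hχ E).continuousOn
  obtain ⟨M, hM⟩ := isCompact_Icc.exists_bound_of_continuousOn hV
  have hA0 : 0 ≤ A := (norm_nonneg _).trans (hA 0 (by norm_num))
  have hB0 : 0 ≤ B := (norm_nonneg _).trans (hB 0 (by norm_num))
  have hM0 : 0 ≤ M := (norm_nonneg _).trans (hM 0 (by norm_num))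
  -- A Lipschitz constant, in the sup norm, of the first-order system for all energies within `1` of
  -- `E`; `K ≥ 1` covers the row `u' = u'`.
  set K : ℝ := max 1 ((M + (‖E‖ + 1)) / h ^ 2) with hK
  have hK1 : 1 ≤ K := le_max_left _ _
  set C : ℝ := A / h ^ 2 * (Real.exp (K * 2) - 1) with hC
  have hC0 : 0 ≤ C := mul_nonneg (by positivity)
    (sub_nonneg.2 (Real.one_le_exp (by positivity)))
  have gron : ∀ E', ‖E' - E‖ ≤ 1 → ∀ x ∈ Icc (-1 : ℝ) 1, ‖φ E' x - φ E x‖ ≤ C * ‖E' - E‖ := by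
    intro E' hE' x hx
    have h1 := norm_le_gronwallBound_of_norm_deriv_right_le (a := -1) (b := 1) (δ := 0) (K := K)
      (ε := ‖E' - E‖ * A / h ^ 2)
      (f := fun x => (φ E' x - φ E x, φ' E' x - φ' E x))
      (f' := fun x => (φ' E' x - φ' E x, (V x - E') / (h : ℂ) ^ 2 * φ E' x -
        (V x - E) / (h : ℂ) ^ 2 * φ E x))
      (((hφ E').continuousOn.sub (hφ E).continuousOn).prodMk
        ((hφ E').continuousOn_deriv.sub (hφ E).continuousOn_deriv))
      (fun y hy => by
        have hy' : y ∈ Icc (-1 : ℝ) 1 := ⟨hy.1, hy.2.le⟩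
        exact ((((hφ E').hasDerivAt y hy').sub ((hφ E).hasDerivAt y hy')).prodMk
          (((hφ E').hasDerivAt_deriv y hy').sub
            ((hφ E).hasDerivAt_deriv y hy'))).hasDerivWithinAt)
      (by simp [hl, hl']) (fun y hy => ?_) x hx
    · refine (norm_fst_le _).trans (h1.trans ?_)
      rw [gronwallBound_of_K_ne_0 (by positivity)]
      simp only [zero_mul, zero_add]
      have e1 : Real.exp (K * (x - -1)) ≤ Real.exp (K * 2) := by
        have := hx.2
        gcongr; linarith
      have e2 : 1 ≤ Real.exp (K * (x - -1)) :=
        Real.one_le_exp (mul_nonneg (by positivity) (by linarith [hx.1]))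
      calc ‖E' - E‖ * A / h ^ 2 / K * (Real.exp (K * (x - -1)) - 1)
          ≤ ‖E' - E‖ * A / h ^ 2 / 1 * (Real.exp (K * 2) - 1) := by
            gcongr
        _ = C * ‖E' - E‖ := by rw [hC]; ring
    · have hy' : y ∈ Icc (-1 : ℝ) 1 := ⟨hy.1, hy.2.le⟩
      have e1 : ‖φ E' y - φ E y‖ ≤ ‖(φ E' y - φ E y, φ' E' y - φ' E y)‖ :=
        norm_fst_le (φ E' y - φ E y, φ' E' y - φ' E y)
      have e2 : ‖φ' E' y - φ' E y‖ ≤ ‖(φ E' y - φ E y, φ' E' y - φ' E y)‖ :=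
        norm_snd_le (φ E' y - φ E y, φ' E' y - φ' E y)
      set d := ‖(φ E' y - φ E y, φ' E' y - φ' E y)‖ with hd
      have hd0 : 0 ≤ d := norm_nonneg _
      have e0 : 0 ≤ ‖E' - E‖ * A / h ^ 2 := by positivity
      rw [Prod.norm_def]
      refine max_le ?_ ?_
      · simp only
        nlinarith
      · simp only
        have e3 : (V y - E') / (h : ℂ) ^ 2 * φ E' y - (V y - E) / (h : ℂ) ^ 2 * φ E y =
            (V y - E') / (h : ℂ) ^ 2 * (φ E' y - φ E y) - (E' - E) * φ E y / (h : ℂ) ^ 2 := by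
          ring
        rw [e3]
        refine (norm_sub_le _ _).trans (add_le_add ?_ ?_)
        · rw [norm_mul]
          refine mul_le_mul (le_trans ?_ (le_max_right _ _)) e1 (norm_nonneg _) (by positivity)
          rw [norm_div, norm_pow, Complex.norm_real, Real.norm_of_nonneg hh.le]
          have e4 : ‖V y - E'‖ ≤ M + (‖E‖ + 1) := by
            have := norm_sub_le (V y) E'
            have := hM y hy'
            have := norm_le_norm_add_norm_sub' E' E
            linarith
          gcongr
        · rw [norm_div, norm_mul, norm_pow, Complex.norm_real, Real.norm_of_nonneg hh.le]
          have := hA y hy'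
          gcongr
  have hder : HasDerivAt (fun E => φ E 1)
      ((∫ x in (-1 : ℝ)..1, φ E x * χ E x) / (h : ℂ) ^ 2) E := by
    rw [hasDerivAt_iff_isLittleO]
    refine Asymptotics.IsBigO.trans_isLittleO ?_ (Asymptotics.isLittleO_pow_sub_sub E one_lt_two)
    refine Asymptotics.IsBigO.of_bound (C * B * 2 / h ^ 2) ?_
    filter_upwards [Metric.closedBall_mem_nhds E one_pos] with E' hE'
    rw [mem_closedBall_iff_norm] at hE'
    have w1 := wr E E
    have w2 := wr E E'
    have hi : ∀ E', IntervalIntegrable (fun x => φ E' x * χ E x) volume (-1) 1 := fun E' =>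
      ContinuousOn.intervalIntegrable (by
        rw [hI]; exact (hφ E').continuousOn.mul (hχ E).continuousOn)
    have e1 : φ E' 1 - φ E 1 - (E' - E) • ((∫ x in (-1 : ℝ)..1, φ E x * χ E x) / (h : ℂ) ^ 2) =
        (E' - E) / (h : ℂ) ^ 2 * ∫ x in (-1 : ℝ)..1, (φ E' x * χ E x - φ E x * χ E x) := by
      rw [intervalIntegral.integral_sub (hi E') (hi E), smul_eq_mul]
      linear_combination w2 - w1
    have e2 : ‖∫ x in (-1 : ℝ)..1, (φ E' x * χ E x - φ E x * χ E x)‖ ≤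
        C * ‖E' - E‖ * B * |1 - (-1)| := by
      refine intervalIntegral.norm_integral_le_of_norm_le_const fun x hx => ?_
      rw [uIoc_of_le (by norm_num)] at hx
      have hx' : x ∈ Icc (-1 : ℝ) 1 := ⟨hx.1.le, hx.2⟩
      rw [← sub_mul, norm_mul]
      exact mul_le_mul (gron E' hE' x hx') (hB x hx') (norm_nonneg _) (by positivity)
    have e3 : |(1 : ℝ) - (-1)| = 2 := by norm_num
    rw [e3] at e2
    rw [e1, norm_mul, norm_div, norm_pow, Complex.norm_real, Real.norm_of_nonneg hh.le, norm_pow,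
      norm_norm]
    calc ‖E' - E‖ / h ^ 2 * ‖∫ x in (-1 : ℝ)..1, (φ E' x * χ E x - φ E x * χ E x)‖
        ≤ ‖E' - E‖ / h ^ 2 * (C * ‖E' - E‖ * B * 2) := by gcongr
      _ = _ := by ring
  exact hder.differentiableAt

/-! ### A neighborhood of the interval. -/

/-- `N` is a bounded convex open neighborhood of `[-1, 1]`, containing the `δ`-balls around the
points of `[-1, 1]`, on which `V` is holomorphic and `V`, `V'`, `V''` are bounded by `M`. -/
structure IsGoodNeighborhood (V : ℂ → ℂ) (N : Set ℂ) (δ M r : ℝ) : Prop where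
  convex : Convex ℝ N
  isOpen : IsOpen N
  pos : 0 < δ
  closedBall_subset : ∀ x ∈ Icc (-1 : ℝ) 1, Metric.closedBall (x : ℂ) δ ⊆ N
  diam_le : ∀ z ∈ N, ∀ w ∈ N, ‖z - w‖ ≤ r
  differentiableOn : DifferentiableOn ℂ V N
  norm_le : ∀ z ∈ N, ‖V z‖ ≤ M
  norm_deriv_le : ∀ z ∈ N, ‖deriv V z‖ ≤ M
  norm_deriv_deriv_le : ∀ z ∈ N, ‖deriv (deriv V) z‖ ≤ M

/-- A thickening of the segment is convex, and a closed thickening inside `D` is compact, which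
bounds `V` and its derivatives. -/
theorem exists_isGoodNeighborhood {D : Set ℂ} {V : ℂ → ℂ} (hDo : IsOpen D)
    (hD : ∀ x ∈ Icc (-1 : ℝ) 1, (x : ℂ) ∈ D) (hV : DifferentiableOn ℂ V D) :
    ∃ N δ M r, IsGoodNeighborhood V N δ M r := by
  set S : Set ℂ := (fun x : ℝ => (x : ℂ)) '' Icc (-1) 1 with hS
  have hSc : IsCompact S := isCompact_Icc.image Complex.continuous_ofReal
  have hSconv : Convex ℝ S := (convex_Icc (-1 : ℝ) 1).linear_image Complex.ofRealCLM.toLinearMap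
  obtain ⟨ε, hε, hεD⟩ := hSc.exists_cthickening_subset_open hDo (by rintro _ ⟨x, hx, rfl⟩; exact hD x hx)
  have hK : IsCompact (Metric.cthickening ε S) := hSc.cthickening
  have hV1 := hV.deriv hDo
  have hV2 := hV1.deriv hDo
  obtain ⟨M₀, hM₀⟩ := hK.exists_bound_of_continuousOn (hV.continuousOn.mono hεD)
  obtain ⟨M₁, hM₁⟩ := hK.exists_bound_of_continuousOn (hV1.continuousOn.mono hεD)
  obtain ⟨M₂, hM₂⟩ := hK.exists_bound_of_continuousOn (hV2.continuousOn.mono hεD)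
  have hsub := Metric.thickening_subset_cthickening ε S
  obtain ⟨r, hr⟩ := Metric.isBounded_iff.1 hK.isBounded
  refine ⟨Metric.thickening ε S, ε / 2, max M₀ (max M₁ M₂), r,
    hSconv.thickening ε, Metric.isOpen_thickening, by positivity, ?_, ?_,
    hV.mono (hsub.trans hεD), ?_, ?_, ?_⟩
  · intro x hx y hy
    rw [Metric.mem_thickening_iff]
    exact ⟨x, mem_image_of_mem _ hx, (Metric.mem_closedBall.1 hy).trans_lt (by linarith)⟩
  · intro z hz w hw
    rw [← dist_eq_norm]
    exact hr (hsub hz) (hsub hw)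
  · exact fun z hz => (hM₀ z (hsub hz)).trans (le_max_left _ _)
  · exact fun z hz => (hM₁ z (hsub hz)).trans ((le_max_left _ _).trans (le_max_right _ _))
  · exact fun z hz => (hM₂ z (hsub hz)).trans ((le_max_right _ _).trans (le_max_right _ _))

/-! ### Principal roots. -/

namespace Complex

theorem cpow_half_sq (z : ℂ) : (z ^ (1 / 2 : ℂ)) ^ 2 = z := by
  rw [← cpow_nat_mul]; norm_num

theorem cpow_quarter_sq (z : ℂ) : (z ^ (1 / 4 : ℂ)) ^ 2 = z ^ (1 / 2 : ℂ) := by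
  rw [← cpow_nat_mul]; norm_num

theorem cpow_half_re_nonneg (z : ℂ) : 0 ≤ (z ^ (1 / 2 : ℂ)).re := by
  rcases eq_or_ne z 0 with rfl | hz
  · simp
  · rw [cpow_def_of_ne_zero hz, exp_re]
    refine mul_nonneg (Real.exp_pos _).le (Real.cos_nonneg_of_mem_Icc ?_)
    have h1 : (log z * (1 / 2)).im = arg z / 2 := by
      rw [show (1 / 2 : ℂ) = ((1 / 2 : ℝ) : ℂ) by norm_num, im_mul_ofReal, log_im]; ring
    rw [h1]
    constructor <;> linarith [neg_pi_lt_arg z, arg_le_pi z]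

/-- Factor `z - 1 = (√z - 1)(√z + 1)`; the second factor has real part at least `1`. -/
theorem norm_cpow_half_sub_one_le (z : ℂ) : ‖z ^ (1 / 2 : ℂ) - 1‖ ≤ ‖z - 1‖ := by
  have h1 : (z ^ (1 / 2 : ℂ) - 1) * (z ^ (1 / 2 : ℂ) + 1) = z - 1 := by
    linear_combination cpow_half_sq z
  have h2 : 1 ≤ ‖z ^ (1 / 2 : ℂ) + 1‖ := by
    refine le_trans ?_ (re_le_norm _)
    simpa using cpow_half_re_nonneg z
  rw [← h1, norm_mul]
  exact le_mul_of_one_le_right (norm_nonneg _) h2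

end Complex

/-! ### The action at large energy. -/

/-- The action `∫_{-1}^1 √(E - V)`, divided by `√E₀`. -/
noncomputable def actionRatio (V : ℂ → ℂ) (E₀ E : ℂ) : ℂ :=
  ∫ x in (-1 : ℝ)..1, ((E - V x) / E₀) ^ (1 / 2 : ℂ)

/-- The action `∫_{-1}^1 √(E - V)`, for the branch of the square root that is close to `√E₀`. -/
noncomputable def action (V : ℂ → ℂ) (E₀ E : ℂ) : ℂ :=
  E₀ ^ (1 / 2 : ℂ) * actionRatio V E₀ E

/-- The branch of `(E - V)^{1/4}` close to `E₀^{1/4}`. -/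
noncomputable def quarticRoot (V : ℂ → ℂ) (E₀ E z : ℂ) : ℂ :=
  E₀ ^ (1 / 4 : ℂ) * ((E - V z) / E₀) ^ (1 / 4 : ℂ)

/-- The energy `E₀` is so large that `V` is small compared with it. -/
structure IsLargeEnergy (δ M η : ℝ) (E₀ : ℂ) : Prop where
  ne_zero : E₀ ≠ 0
  nonneg : 0 ≤ η
  le_eighth : η ≤ 1 / 8
  le_mul : 4 * η ≤ (1 - η) * δ
  bound_le : M ≤ η / 2 * ‖E₀‖

section Energy

variable {V : ℂ → ℂ} {N : Set ℂ} {δ M r η : ℝ} {E₀ E : ℂ}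

theorem IsGoodNeighborhood.mem (hN : IsGoodNeighborhood V N δ M r) {x : ℝ}
    (hx : x ∈ Icc (-1 : ℝ) 1) : (x : ℂ) ∈ N :=
  hN.closedBall_subset x hx (Metric.mem_closedBall_self hN.pos.le)

theorem IsGoodNeighborhood.continuousOn_real (hN : IsGoodNeighborhood V N δ M r) :
    ContinuousOn (fun x : ℝ => V x) (Icc (-1) 1) :=
  hN.differentiableOn.continuousOn.comp Complex.continuous_ofReal.continuousOn fun _ hx => hN.mem hx

/-- Half of `η` pays for `E - E₀`, half for `V`. Near `1` the principal powers of the ratio are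
holomorphic, wherever `E₀` lies with respect to the branch cut. -/
theorem norm_ratio_sub_one_le (hN : IsGoodNeighborhood V N δ M r) (hL : IsLargeEnergy δ M η E₀)
    (hE : ‖E - E₀‖ ≤ η / 2 * ‖E₀‖) {z : ℂ} (hz : z ∈ N) : ‖(E - V z) / E₀ - 1‖ ≤ η := by
  have h0 : 0 < ‖E₀‖ := norm_pos_iff.2 hL.ne_zero
  have h1 : (E - V z) / E₀ - 1 = (E - E₀ - V z) / E₀ := by
    field_simp [hL.ne_zero]; ring
  rw [h1, norm_div, div_le_iff₀ h0]
  have := norm_sub_le (E - E₀) (V z)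
  have := hN.norm_le z hz
  have := hL.bound_le
  linarith

theorem ratio_mem_slitPlane (hN : IsGoodNeighborhood V N δ M r) (hL : IsLargeEnergy δ M η E₀)
    (hE : ‖E - E₀‖ ≤ η / 2 * ‖E₀‖) {z : ℂ} (hz : z ∈ N) : (E - V z) / E₀ ∈ Complex.slitPlane := by
  refine Or.inl ?_
  have h1 := (Complex.abs_re_le_norm _).trans (norm_ratio_sub_one_le hN hL hE hz)
  have h2 := (abs_le.1 h1).1
  have h3 := hL.le_eighth
  rw [Complex.sub_re, Complex.one_re] at h2
  linarith

theorem norm_half_le_norm_sub (hN : IsGoodNeighborhood V N δ M r) (hL : IsLargeEnergy δ M η E₀)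
    (hE : ‖E - E₀‖ ≤ η / 2 * ‖E₀‖) {z : ℂ} (hz : z ∈ N) : ‖E₀‖ / 2 ≤ ‖E - V z‖ := by
  have h1 := norm_ratio_sub_one_le hN hL hE hz
  have h2 := hL.le_eighth
  have h3 := norm_sub_norm_le (1 : ℂ) (1 - (E - V z) / E₀)
  rw [norm_one, norm_sub_rev, sub_sub_cancel, norm_div] at h3
  have h0 : 0 < ‖E₀‖ := norm_pos_iff.2 hL.ne_zero
  have h4 : 1 / 2 ≤ ‖E - V z‖ / ‖E₀‖ := by linarith
  rw [le_div_iff₀ h0] at h4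
  linarith

theorem quarticRoot_sq (z : ℂ) : quarticRoot V E₀ E z ^ 2 =
    E₀ ^ (1 / 2 : ℂ) * ((E - V z) / E₀) ^ (1 / 2 : ℂ) := by
  rw [quarticRoot, mul_pow, Complex.cpow_quarter_sq, Complex.cpow_quarter_sq]

theorem quarticRoot_pow_four (h0 : E₀ ≠ 0) (z : ℂ) : quarticRoot V E₀ E z ^ 4 = E - V z := by
  rw [show 4 = 2 * 2 by norm_num, pow_mul, quarticRoot_sq, mul_pow, Complex.cpow_half_sq,
    Complex.cpow_half_sq]
  field_simp

theorem hasDerivAt_quarticRoot (hN : IsGoodNeighborhood V N δ M r) (hL : IsLargeEnergy δ M η E₀)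
    (hE : ‖E - E₀‖ ≤ η / 2 * ‖E₀‖) {z : ℂ} (hz : z ∈ N) :
    HasDerivAt (quarticRoot V E₀ E)
      (-(deriv V z * quarticRoot V E₀ E z) / (4 * (E - V z))) z := by
  have hV := (hN.differentiableOn.differentiableAt (hN.isOpen.mem_nhds hz)).hasDerivAt
  have hs := ratio_mem_slitPlane hN hL hE hz
  have h1 := (((hV.const_sub E).div_const E₀).cpow_const (c := 1 / 4) hs).const_mul
    (E₀ ^ (1 / 4 : ℂ))
  refine h1.congr_deriv ?_
  have hne := Complex.slitPlane_ne_zero hs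
  have h0 := hL.ne_zero
  have hEV : E - V z ≠ 0 := fun h => hne (by rw [h, zero_div])
  rw [Complex.cpow_sub _ _ hne, Complex.cpow_one, quarticRoot]
  field_simp

theorem continuousOn_ratio_cpow (hN : IsGoodNeighborhood V N δ M r) (hL : IsLargeEnergy δ M η E₀)
    (hE : ‖E - E₀‖ ≤ η / 2 * ‖E₀‖) (a : ℂ) :
    ContinuousOn (fun x : ℝ => ((E - V x) / E₀) ^ a) (Icc (-1) 1) :=
  ((continuousOn_const.sub hN.continuousOn_real).div_const _).cpow_const fun _ hx =>
    ratio_mem_slitPlane hN hL hE (hN.mem hx)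

theorem norm_actionRatio_sub_two_le (hN : IsGoodNeighborhood V N δ M r)
    (hL : IsLargeEnergy δ M η E₀) (hE : ‖E - E₀‖ ≤ η / 2 * ‖E₀‖) :
    ‖actionRatio V E₀ E - 2‖ ≤ 2 * η := by
  have hi : IntervalIntegrable (fun x : ℝ => ((E - V x) / E₀) ^ (1 / 2 : ℂ)) volume (-1) 1 :=
    ContinuousOn.intervalIntegrable (by
      rw [uIcc_of_le (by norm_num)]; exact continuousOn_ratio_cpow hN hL hE _)
  have h1 : actionRatio V E₀ E - 2 =
      ∫ x in (-1 : ℝ)..1, (((E - V x) / E₀) ^ (1 / 2 : ℂ) - 1) := by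
    rw [intervalIntegral.integral_sub hi intervalIntegrable_const, actionRatio]
    norm_num
  rw [h1]
  have := intervalIntegral.norm_integral_le_of_norm_le_const (a := (-1 : ℝ)) (b := 1) (C := η)
    (f := fun x : ℝ => ((E - V x) / E₀) ^ (1 / 2 : ℂ) - 1) (fun x hx => by
      rw [uIoc_of_le (by norm_num)] at hx
      exact (Complex.norm_cpow_half_sub_one_le _).trans
        (norm_ratio_sub_one_le hN hL hE (hN.mem ⟨hx.1.le, hx.2⟩)))
  refine this.trans_eq ?_
  norm_num
  ring

theorem norm_action_le (hN : IsGoodNeighborhood V N δ M r) (hL : IsLargeEnergy δ M η E₀)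
    (hE : ‖E - E₀‖ ≤ η / 2 * ‖E₀‖) : ‖action V E₀ E‖ ≤ 3 * ‖E₀ ^ (1 / 2 : ℂ)‖ := by
  have h1 := norm_actionRatio_sub_two_le hN hL hE
  have h2 := norm_le_norm_add_norm_sub' (actionRatio V E₀ E) 2
  have h3 := hL.le_eighth
  rw [Complex.norm_two] at h2
  rw [action, norm_mul, mul_comm]
  exact mul_le_mul_of_nonneg_right (by linarith) (norm_nonneg _)

theorem hasDerivAt_action (hN : IsGoodNeighborhood V N δ M r) (hL : IsLargeEnergy δ M η E₀)
    (hE : ‖E - E₀‖ < η / 2 * ‖E₀‖) :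
    HasDerivAt (action V E₀) (E₀ ^ (1 / 2 : ℂ) *
      ∫ x in (-1 : ℝ)..1, 1 / (2 * E₀) * (((E - V x) / E₀) ^ (1 / 2 : ℂ))⁻¹) E := by
  have h0 := hL.ne_zero
  have h0' : 0 < ‖E₀‖ := norm_pos_iff.2 h0
  set s := Metric.ball E₀ (η / 2 * ‖E₀‖) with hs
  have hsE : s ∈ 𝓝 E := Metric.isOpen_ball.mem_nhds (mem_ball_iff_norm.2 hE)
  have hmem : ∀ E' ∈ s, ‖E' - E₀‖ ≤ η / 2 * ‖E₀‖ := fun E' hE' => (mem_ball_iff_norm.1 hE').le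
  have hI : uIcc (-1 : ℝ) 1 = Icc (-1) 1 := uIcc_of_le (by norm_num)
  have hIoc : uIoc (-1 : ℝ) 1 = Ioc (-1) 1 := uIoc_of_le (by norm_num)
  have hne : ∀ E' ∈ s, ∀ x ∈ Icc (-1 : ℝ) 1, ((E' - V x) / E₀) ^ (1 / 2 : ℂ) ≠ 0 := by
    intro E' hE' x hx h
    have := Complex.cpow_half_sq ((E' - V x) / E₀)
    rw [h] at this
    exact Complex.slitPlane_ne_zero (ratio_mem_slitPlane hN hL (hmem E' hE') (hN.mem hx))
      (by rw [← this]; simp)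
  have hmeas : ∀ f : ℝ → ℂ, ContinuousOn f (Icc (-1) 1) →
      AEStronglyMeasurable f (volume.restrict (uIoc (-1) 1)) := by
    intro f hf
    rw [hIoc]
    exact (hf.mono Ioc_subset_Icc_self).aestronglyMeasurable measurableSet_Ioc
  refine HasDerivAt.const_mul _ ?_
  refine (intervalIntegral.hasDerivAt_integral_of_dominated_loc_of_deriv_le
    (F := fun (E : ℂ) (x : ℝ) => ((E - V x) / E₀) ^ (1 / 2 : ℂ))
    (F' := fun (E : ℂ) (x : ℝ) => 1 / (2 * E₀) * (((E - V x) / E₀) ^ (1 / 2 : ℂ))⁻¹)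
    (bound := fun _ => 1 / ‖E₀‖) hsE ?_ ?_ ?_ ?_ intervalIntegrable_const ?_).2
  · filter_upwards [hsE] with E' hE'
    exact hmeas _ (continuousOn_ratio_cpow hN hL (hmem E' hE') _)
  · exact ContinuousOn.intervalIntegrable (by
      rw [hI]; exact continuousOn_ratio_cpow hN hL hE.le _)
  · exact hmeas _ (continuousOn_const.mul
      ((continuousOn_ratio_cpow hN hL hE.le _).inv₀ (hne E (mem_ball_iff_norm.2 hE))))
  · refine ae_of_all _ fun x hx E' hE' => ?_
    rw [hIoc] at hx
    have hx' : x ∈ Icc (-1 : ℝ) 1 := ⟨hx.1.le, hx.2⟩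
    have h1 := (Complex.norm_cpow_half_sub_one_le _).trans
      (norm_ratio_sub_one_le hN hL (hmem E' hE') (hN.mem hx'))
    have h2 := hL.le_eighth
    have h3 := norm_sub_norm_le (1 : ℂ) (1 - ((E' - V x) / E₀) ^ (1 / 2 : ℂ))
    rw [norm_one, norm_sub_rev, sub_sub_cancel] at h3
    have h4 : 1 / 2 ≤ ‖((E' - V x) / E₀) ^ (1 / 2 : ℂ)‖ := by linarith
    rw [norm_mul, norm_div, norm_mul, norm_one, Complex.norm_two, norm_inv]
    calc 1 / (2 * ‖E₀‖) * ‖((E' - V x) / E₀) ^ (1 / 2 : ℂ)‖⁻¹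
        ≤ 1 / (2 * ‖E₀‖) * (1 / 2)⁻¹ := by gcongr
      _ = 1 / ‖E₀‖ := by field_simp
  · refine ae_of_all _ fun x hx E' hE' => ?_
    rw [hIoc] at hx
    have hx' : x ∈ Icc (-1 : ℝ) 1 := ⟨hx.1.le, hx.2⟩
    have hsl := ratio_mem_slitPlane hN hL (hmem E' hE') (hN.mem hx')
    have h1 := (((hasDerivAt_id E').sub_const (V x)).div_const E₀).cpow_const (c := 1 / 2) hsl
    refine h1.congr_deriv ?_
    have h2 := Complex.slitPlane_ne_zero hsl
    have h3 := hne E' hE' x hx'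
    have h4 := Complex.cpow_half_sq ((E' - V x) / E₀)
    simp only [id]
    rw [Complex.cpow_sub _ _ h2, Complex.cpow_one]
    set p := ((E' - V x) / E₀) ^ (1 / 2 : ℂ) with hp
    rw [← h4]
    field_simp

/-- The integrand is within `1/4` of `1` after removing `1 / (2 E₀)`, so the integral stays near `2`
and the derivative near `1 / √E₀`. -/
theorem le_norm_deriv_action (hN : IsGoodNeighborhood V N δ M r) (hL : IsLargeEnergy δ M η E₀)
    (hE : ‖E - E₀‖ ≤ η / 2 * ‖E₀‖) :
    1 / (2 * ‖E₀ ^ (1 / 2 : ℂ)‖) ≤ ‖E₀ ^ (1 / 2 : ℂ) *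
      ∫ x in (-1 : ℝ)..1, 1 / (2 * E₀) * (((E - V x) / E₀) ^ (1 / 2 : ℂ))⁻¹‖ := by
  have hq : ∀ x ∈ Icc (-1 : ℝ) 1, ‖((E - V x) / E₀) ^ (1 / 2 : ℂ) - 1‖ ≤ 1 / 8 := fun x hx =>
    (Complex.norm_cpow_half_sub_one_le _).trans
      ((norm_ratio_sub_one_le hN hL hE (hN.mem hx)).trans hL.le_eighth)
  have hbound : ∀ q : ℂ, ‖q - 1‖ ≤ 1 / 8 → ‖q⁻¹ - 1‖ ≤ 1 / 4 := by
    intro q hq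
    have h3 := norm_sub_norm_le (1 : ℂ) (1 - q)
    rw [norm_one, norm_sub_rev, sub_sub_cancel] at h3
    have hq0 : q ≠ 0 := fun h => by rw [h, zero_sub, norm_neg, norm_one] at hq; linarith
    rw [show q⁻¹ - 1 = (1 - q) / q by field_simp, norm_div, norm_sub_rev,
      div_le_iff₀ (norm_pos_iff.2 hq0)]
    linarith
  have hc : ContinuousOn (fun x : ℝ => (((E - V x) / E₀) ^ (1 / 2 : ℂ))⁻¹) (Icc (-1) 1) :=
    (continuousOn_ratio_cpow hN hL hE _).inv₀ fun x hx h => by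
      have := hq x hx; rw [h] at this; norm_num at this
  have hi : IntervalIntegrable (fun x : ℝ => (((E - V x) / E₀) ^ (1 / 2 : ℂ))⁻¹) volume (-1) 1 :=
    ContinuousOn.intervalIntegrable (by rwa [uIcc_of_le (by norm_num)])
  set J := ∫ x in (-1 : ℝ)..1, (((E - V x) / E₀) ^ (1 / 2 : ℂ))⁻¹ with hJ
  have h1 : J - 2 = ∫ x in (-1 : ℝ)..1, ((((E - V x) / E₀) ^ (1 / 2 : ℂ))⁻¹ - 1) := by
    rw [intervalIntegral.integral_sub hi intervalIntegrable_const, hJ]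
    norm_num
  have h2 : ‖J - 2‖ ≤ 1 / 4 * |1 - (-1)| := by
    rw [h1]
    refine intervalIntegral.norm_integral_le_of_norm_le_const fun x hx => ?_
    rw [uIoc_of_le (by norm_num)] at hx
    exact hbound _ (hq x ⟨hx.1.le, hx.2⟩)
  have h3 : |(1 : ℝ) - (-1)| = 2 := by norm_num
  rw [h3] at h2
  have h4 : 1 ≤ ‖J‖ := by
    have := norm_sub_norm_le (2 : ℂ) (2 - J)
    rw [Complex.norm_two, norm_sub_rev, sub_sub_cancel] at this
    linarith
  have h0 := hL.ne_zero
  have h5 : ‖E₀‖ = ‖E₀ ^ (1 / 2 : ℂ)‖ ^ 2 := by rw [← norm_pow, Complex.cpow_half_sq]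
  have h6 : 0 < ‖E₀ ^ (1 / 2 : ℂ)‖ := by
    refine norm_pos_iff.2 fun h => h0 ?_
    rw [← Complex.cpow_half_sq E₀, h]; simp
  rw [intervalIntegral.integral_const_mul, norm_mul, norm_mul, norm_div, norm_mul, norm_one,
    Complex.norm_two, ← hJ, h5]
  calc 1 / (2 * ‖E₀ ^ (1 / 2 : ℂ)‖) = 1 / (2 * ‖E₀ ^ (1 / 2 : ℂ)‖) * 1 := by ring
    _ ≤ 1 / (2 * ‖E₀ ^ (1 / 2 : ℂ)‖) * ‖J‖ := by gcongr
    _ = _ := by field_simp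

/-- `p = i √(E₀ - V)` is a nonvanishing branch, and on the connected interval any other branch is
`p` or `-p`. The factor `i` exchanges real and imaginary parts. -/
theorem actionReZero_iff (hN : IsGoodNeighborhood V N δ M r) (hL : IsLargeEnergy δ M η E₀) :
    ActionReZero V E₀ ↔ (action V E₀ E₀).im = 0 := by
  have hE : ‖E₀ - E₀‖ ≤ η / 2 * ‖E₀‖ := by
    rw [sub_self, norm_zero]; have := hL.nonneg; positivity
  set p : ℝ → ℂ := fun x => Complex.I * (E₀ ^ (1 / 2 : ℂ) * ((E₀ - V x) / E₀) ^ (1 / 2 : ℂ)) with hp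
  have hpc : ContinuousOn p (Icc (-1) 1) :=
    continuousOn_const.mul (continuousOn_const.mul (continuousOn_ratio_cpow hN hL hE _))
  have hp2 : ∀ x, p x ^ 2 = V x - E₀ := by
    intro x
    simp only [hp]
    rw [mul_pow, mul_pow, Complex.I_sq, Complex.cpow_half_sq, Complex.cpow_half_sq]
    field_simp [hL.ne_zero]
    ring
  have hpint : ∫ x in (-1 : ℝ)..1, p x = Complex.I * action V E₀ E₀ := by
    simp only [hp]
    rw [intervalIntegral.integral_const_mul, intervalIntegral.integral_const_mul]
    rfl
  have hre : (Complex.I * action V E₀ E₀).re = -(action V E₀ E₀).im := by simp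
  constructor
  · rintro ⟨w, ⟨hwc, hw2⟩, hw⟩
    have hpne : ∀ {x : ℝ}, x ∈ Icc (-1 : ℝ) 1 → p x ≠ 0 := by
      intro x hx h
      have h1 := hp2 x
      rw [h] at h1
      have h2 := norm_half_le_norm_sub hN hL hE (hN.mem hx)
      rw [← neg_sub, ← h1] at h2
      have := norm_pos_iff.2 hL.ne_zero
      norm_num at h2
      linarith
    have hcases := (isPreconnected_Icc (a := (-1 : ℝ)) (b := 1)).eq_or_eq_neg_of_sq_eq hwc hpc
      (fun x hx => by simp only [Pi.pow_apply]; rw [hw2 x hx, hp2]) hpne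
    rcases hcases with h | h
    · have : ∫ x in (-1 : ℝ)..1, w x = ∫ x in (-1 : ℝ)..1, p x :=
        intervalIntegral.integral_congr fun x hx => h (by rwa [uIcc_of_le (by norm_num)] at hx)
      rw [this, hpint, hre] at hw
      linarith
    · have : ∫ x in (-1 : ℝ)..1, w x = ∫ x in (-1 : ℝ)..1, -p x :=
        intervalIntegral.integral_congr fun x hx => h (by rwa [uIcc_of_le (by norm_num)] at hx)
      rw [this, intervalIntegral.integral_neg, hpint, Complex.neg_re, hre] at hw
      linarith
  · intro h
    refine ⟨p, ⟨hpc, fun x _ => hp2 x⟩, ?_⟩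
    rw [hpint, hre, h, neg_zero]

end Energy

/-! ### The WKB approximation of the shooting function. -/

section Shooting

variable {V : ℂ → ℂ} {N : Set ℂ} {δ M r η : ℝ} {E₀ E : ℂ}

theorem IsLinSol.isRealLinSol (hN : IsGoodNeighborhood V N δ M r) {Q u u' : ℂ → ℂ}
    (hu : IsLinSol N Q u u') :
    IsRealLinSol (fun x : ℝ => Q x) (fun x : ℝ => u x) (fun x : ℝ => u' x) :=
  ⟨fun x hx => (hu.hasDerivAt x (hN.mem hx)).comp_ofReal,
    fun x hx => (hu.hasDerivAt_deriv x (hN.mem hx)).comp_ofReal⟩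

/-- The constant in the WKB error estimate. -/
noncomputable def wkbConst (M : ℝ) (E₀ : ℂ) : ℝ :=
  M / (4 * (‖E₀‖ / 2) ^ 2) + 5 * M ^ 2 / (16 * (‖E₀‖ / 2) ^ 3)

/-- Liouville–Green transformation: parametrizing by the action at constant speed `Z` turns `(E -
V)^{1/4} u` into a perturbed oscillator with frequency `1/h`. Its initial velocity is `1 / s(-1)`,
whence the prefactor. -/
theorem norm_shooting_sub_sin_le (hN : IsGoodNeighborhood V N δ M r)
    (hL : IsLargeEnergy δ M η E₀) (hE : ‖E - E₀‖ ≤ η / 2 * ‖E₀‖) {h : ℝ} (hh : 0 < h)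
    {u u' : ℂ → ℂ} (hu : IsLinSol N (fun z => (V z - E) / (h : ℂ) ^ 2) u u')
    (hl : u (-1) = 0) (hl' : u' (-1) = 1)
    (hs : h * ‖action V E₀ E‖ * wkbConst M E₀ ≤ 1 / 2) :
    ‖quarticRoot V E₀ E 1 * quarticRoot V E₀ E (-1) * u 1 / h -
        Complex.sin (action V E₀ E / h)‖ ≤
      2 * h * ‖action V E₀ E‖ * wkbConst M E₀ * Real.exp (|(action V E₀ E).im| / h) := by
  have hh' : (h : ℂ) ≠ 0 := by exact_mod_cast hh.ne'
  have h0 := hL.ne_zero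
  have hM0 : 0 ≤ M := (norm_nonneg _).trans (hN.norm_le 0 (by simpa using hN.mem (x := 0) (by norm_num)))
  set q : ℂ → ℂ := fun z => ((E - V z) / E₀) ^ (1 / 2 : ℂ) with hq
  have hqd : DifferentiableOn ℂ q N := fun z hz =>
    (((hN.differentiableOn.differentiableAt (hN.isOpen.mem_nhds hz)).const_sub E).div_const
      E₀).cpow_const (ratio_mem_slitPlane hN hL hE hz) |>.differentiableWithinAt
  obtain ⟨ζ, hζ, hζ0⟩ := exists_primitive_vanishing_at hN.convex hN.isOpen (-1) hqd
  obtain ⟨γ, hγ0, hγ1, hγ⟩ := exists_curve_to_segment hN.convex hN.isOpen hN.closedBall_subset hN.pos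
    hL.nonneg (by linarith [hL.le_eighth]) hL.le_mul
    (fun z hz => (Complex.norm_cpow_half_sub_one_le _).trans (norm_ratio_sub_one_le hN hL hE hz))
    hζ hζ0
  have hζ1 : ζ 1 = actionRatio V E₀ E := by
    have hI : uIcc (-1 : ℝ) 1 = Icc (-1) 1 := uIcc_of_le (by norm_num)
    have := intervalIntegral.integral_eq_sub_of_hasDerivAt (a := (-1 : ℝ)) (b := 1)
      (f := fun x : ℝ => ζ x) (f' := fun x : ℝ => q x)
      (fun x hx => (hζ x (hN.mem (hI ▸ hx))).comp_ofReal)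
      (ContinuousOn.intervalIntegrable (by rw [hI]; exact continuousOn_ratio_cpow hN hL hE _))
    rw [Complex.ofReal_neg, Complex.ofReal_one, hζ0, sub_zero] at this
    exact this.symm
  set Z := action V E₀ E with hZ
  set s := quarticRoot V E₀ E with hsdef
  have hEV : ∀ z ∈ N, E - V z ≠ 0 := fun z hz h => by
    have h1 := norm_half_le_norm_sub hN hL hE hz
    rw [h, norm_zero] at h1
    have := norm_pos_iff.2 h0
    linarith
  have hs4 : ∀ z, s z ^ 4 = E - V z := fun z => quarticRoot_pow_four h0 z
  have hs0 : ∀ z ∈ N, s z ≠ 0 := fun z hz h => hEV z hz (by rw [← hs4, h]; simp)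
  have hγd : ∀ t ∈ Icc (0 : ℝ) 1, HasDerivAt γ (Z / s (γ t) ^ 2) t := by
    intro t ht
    refine (hγ t ht).2.congr_deriv ?_
    have hρ : E₀ ^ (1 / 2 : ℂ) ≠ 0 := fun h => h0 (by rw [← Complex.cpow_half_sq E₀, h]; simp)
    rw [hsdef, quarticRoot_sq, hζ1, hZ, action, mul_div_mul_left _ _ hρ]
  have hVd : ∀ z ∈ N, HasDerivAt V (deriv V z) z := fun z hz =>
    (hN.differentiableOn.differentiableAt (hN.isOpen.mem_nhds hz)).hasDerivAt
  have hVd2 : ∀ z ∈ N, HasDerivAt (deriv V) (deriv (deriv V) z) z := fun z hz =>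
    ((hN.differentiableOn.deriv hN.isOpen).differentiableAt (hN.isOpen.mem_nhds hz)).hasDerivAt
  have hsd : ∀ z ∈ N, HasDerivAt s (-(deriv V z * s z) / (4 * (E - V z))) z := fun z hz =>
    hasDerivAt_quarticRoot hN hL hE hz
  -- The remainder `s⁻³ (s⁻¹ V-dependent terms)` of the transformation, written through `V'` and
  -- `V''`; it does not depend on `h`.
  set b : ℂ → ℂ := fun z => -deriv (deriv V) z / (4 * (E - V z) ^ 2) -
    5 * deriv V z ^ 2 / (16 * (E - V z) ^ 3) with hb
  have hbB : ∀ z ∈ N, ‖b z‖ ≤ wkbConst M E₀ := by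
    intro z hz
    have h1 := norm_half_le_norm_sub hN hL hE hz
    have h2 := hN.norm_deriv_le z hz
    have h3 := hN.norm_deriv_deriv_le z hz
    have h4 := norm_pos_iff.2 h0
    refine (norm_sub_le _ _).trans (add_le_add ?_ ?_)
    · rw [norm_div, norm_neg, norm_mul, norm_pow, show ‖(4 : ℂ)‖ = 4 by norm_num]
      gcongr
    · rw [norm_div, norm_mul, norm_mul, norm_pow, norm_pow, show ‖(5 : ℂ)‖ = 5 by norm_num,
        show ‖(16 : ℂ)‖ = 16 by norm_num]
      gcongr
  have hW : ∀ z ∈ N, HasDerivAt (fun z => s z * u z)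
      (s z ^ 2 * (u' z / s z - deriv V z * u z / (4 * (E - V z) * s z))) z := by
    intro z hz
    refine ((hsd z hz).mul (hu.hasDerivAt z hz)).congr_deriv ?_
    have e1 := hEV z hz
    have e2 := hs0 z hz
    field_simp
    ring
  have hV' : ∀ z ∈ N, HasDerivAt (fun z => u' z / s z - deriv V z * u z / (4 * (E - V z) * s z))
      (s z ^ 2 * (-1 / (h : ℂ) ^ 2 + b z) * (s z * u z)) z := by
    intro z hz
    have e1 := hEV z hz
    have e2 := hs0 z hz
    have e5 : (4 : ℂ) * (E - V z) * s z ≠ 0 := mul_ne_zero (mul_ne_zero (by norm_num) e1) e2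
    have d1 := (hu.hasDerivAt_deriv z hz).div (hsd z hz) e2
    have d2 := ((hVd2 z hz).mul (hu.hasDerivAt z hz)).div
      ((((hVd z hz).const_sub E).const_mul (4 : ℂ)).mul (hsd z hz)) e5
    refine (d1.sub d2).congr_deriv ?_
    have e3 := hs4 z
    simp only [hb, Pi.mul_apply]
    rw [show V z - E = -(E - V z) by ring]
    -- Writing `E - V` as `s⁴` makes the identity rational in `s`.
    set e := E - V z with he
    have e4 : e = s z ^ 4 := e3.symm
    rw [e4]
    field_simp
    ring
  have key := norm_sub_sin_le_of_perturbed_oscillator (Z := Z) (B := wkbConst M E₀) hh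
    (w := fun t => s (γ t) * u (γ t))
    (v := fun t => u' (γ t) / s (γ t) - deriv V (γ t) * u (γ t) / (4 * (E - V (γ t)) * s (γ t)))
    (b := fun t => b (γ t))
    (fun t ht => by
      have := (hW (γ t) (hγ t ht).1).comp t (hγd t ht)
      refine this.congr_deriv ?_
      have e2 := hs0 _ (hγ t ht).1
      field_simp)
    (fun t ht => by
      have := (hV' (γ t) (hγ t ht).1).comp t (hγd t ht)
      refine this.congr_deriv ?_
      have e2 := hs0 _ (hγ t ht).1
      field_simp)
    (fun t ht => hbB _ (hγ t ht).1) (by simp only [hγ0, hl, mul_zero]) hs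
  simp only [hγ0, hγ1, hl, hl', mul_zero, zero_div, sub_zero] at key
  have hm1 : s (-1) ≠ 0 := hs0 _ (by simpa using hN.mem (x := -1) (by norm_num))
  have e1 : s 1 * s (-1) * u 1 / h - Complex.sin (Z / h) =
      s (-1) / h * (s 1 * u 1 - h * (1 / s (-1)) * Complex.sin (Z / h)) := by
    field_simp
  rw [e1, norm_mul, norm_div, Complex.norm_real, Real.norm_of_nonneg hh.le]
  have hn : 0 < ‖s (-1)‖ := norm_pos_iff.2 hm1
  rw [norm_div, norm_one] at key
  calc ‖s (-1)‖ / h * ‖s 1 * u 1 - h * (1 / s (-1)) * Complex.sin (Z / h)‖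
      ≤ ‖s (-1)‖ / h * (2 * h ^ 2 * ‖Z‖ * wkbConst M E₀ * (1 / ‖s (-1)‖) *
          Real.exp (|Z.im| / h)) := by gcongr
    _ = _ := by field_simp

/-- A function whose zeros near `E₀` are the points of the spectrum there, close to
`sin (action / h)`. -/
theorem exists_characteristic_function (hN : IsGoodNeighborhood V N δ M r)
    (hL : IsLargeEnergy δ M η E₀) :
    ∃ (G : ℝ → ℂ → ℂ) (K : ℝ), 0 < K ∧ ∀ h : ℝ, 0 < h → h * K ≤ 1 →
      DifferentiableOn ℂ (G h) (Metric.ball E₀ (η / 2 * ‖E₀‖)) ∧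
      ∀ E ∈ Metric.ball E₀ (η / 2 * ‖E₀‖),
        ‖G h E - Complex.sin (action V E₀ E / h)‖ ≤
          h * K * Real.exp (|(action V E₀ E).im| / h) ∧
        (G h E = 0 → IsEigenvalue h V E) ∧ (G h E ≠ 0 → E ∉ Sp h V) := by
  have hm1 : (-1 : ℂ) ∈ N := by simpa using hN.mem (x := -1) (by norm_num)
  have hp1 : (1 : ℂ) ∈ N := by simpa using hN.mem (x := 1) (by norm_num)
  have hex : ∀ (h : ℝ) (E c a b : ℂ), c ∈ N → ∃ p : (ℂ → ℂ) × (ℂ → ℂ),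
      IsLinSol N (fun z => (V z - E) / (h : ℂ) ^ 2) p.1 p.2 ∧ p.1 c = a ∧ p.2 c = b := by
    intro h E c a b hc
    obtain ⟨u, u', hu⟩ := exists_isLinSol hN.convex hN.isOpen hc
      (Q := fun z => (V z - E) / (h : ℂ) ^ 2) (K := (M + ‖E‖) / ‖(h : ℂ) ^ 2‖)
      ((hN.differentiableOn.sub_const E).div_const _) (fun z hz => by
        rw [norm_div]
        have := (norm_sub_le (V z) E).trans (add_le_add_left (hN.norm_le z hz) _)
        gcongr) (fun z hz => hN.diam_le z hz c hc) a b
    exact ⟨(u, u'), hu⟩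
  choose φ hφ hφl hφl' using fun (h : ℝ) (E : ℂ) => hex h E (-1) 0 1 hm1
  choose χ hχ hχr hχr' using fun (h : ℝ) (E : ℂ) => hex h E 1 0 1 hp1
  have h0 := hL.ne_zero
  have hM0 : 0 ≤ M := (norm_nonneg _).trans (hN.norm_le 1 hp1)
  have hB0 : 0 ≤ wkbConst M E₀ := by unfold wkbConst; positivity
  -- The quartic roots are holomorphic in `E` and nonzero, so they do not change the zeros. In the
  -- constant, `6 = 2 * 3` combines the oscillator bound with `norm_action_le`; the `+ 1` ensures
  -- positivity.
  refine ⟨fun h E => quarticRoot V E₀ E 1 * quarticRoot V E₀ E (-1) * (φ h E).1 1 / h,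
    6 * ‖E₀ ^ (1 / 2 : ℂ)‖ * wkbConst M E₀ + 1, by positivity, fun h hh hK => ?_⟩
  have hh' : (h : ℂ) ≠ 0 := by exact_mod_cast hh.ne'
  have hV := hN.continuousOn_real
  have hφR : ∀ E, IsRealLinSol (fun x : ℝ => (V x - E) / (h : ℂ) ^ 2)
    (fun x : ℝ => (φ h E).1 x) (fun x : ℝ => (φ h E).2 x) := fun E => (hφ h E).isRealLinSol hN
  have hχR : ∀ E, IsRealLinSol (fun x : ℝ => (V x - E) / (h : ℂ) ^ 2)
    (fun x : ℝ => (χ h E).1 x) (fun x : ℝ => (χ h E).2 x) := fun E => (hχ h E).isRealLinSol hN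
  have hmem : ∀ E ∈ Metric.ball E₀ (η / 2 * ‖E₀‖), ‖E - E₀‖ ≤ η / 2 * ‖E₀‖ :=
    fun E hE => (mem_ball_iff_norm.1 hE).le
  refine ⟨?_, fun E hE => ⟨?_, fun hG => ?_, fun hG => ?_⟩⟩
  · have hroot : ∀ z ∈ N, DifferentiableOn ℂ (fun E => quarticRoot V E₀ E z)
        (Metric.ball E₀ (η / 2 * ‖E₀‖)) := by
      intro z hz E hE
      exact ((((differentiableAt_id.sub_const (V z)).div_const E₀).cpow_const
        (ratio_mem_slitPlane hN hL (hmem E hE) hz)).const_mul _).differentiableWithinAt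
    have hd := differentiable_shooting hh hV hφR hχR (fun E => by simpa using hφl h E)
      (fun E => by simpa using hφl' h E) (fun E => by simpa using hχr h E)
      (fun E => by simpa using hχr' h E)
    simp only [Complex.ofReal_one] at hd
    exact (((hroot 1 hp1).mul (hroot (-1) hm1)).mul hd.differentiableOn).div_const _
  · have hZ := norm_action_le hN hL (hmem E hE)
    have h1 : h * ‖action V E₀ E‖ * wkbConst M E₀ ≤
        h * (3 * ‖E₀ ^ (1 / 2 : ℂ)‖) * wkbConst M E₀ := by gcongr
    refine (norm_shooting_sub_sin_le hN hL (hmem E hE) hh (hφ h E) (hφl h E) (hφl' h E)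
      (by nlinarith)).trans ?_
    have h2 : 2 * h * ‖action V E₀ E‖ * wkbConst M E₀ ≤
      h * (6 * ‖E₀ ^ (1 / 2 : ℂ)‖ * wkbConst M E₀ + 1) := by nlinarith
    gcongr
  · have hroot : ∀ z ∈ N, quarticRoot V E₀ E z ≠ 0 := fun z hz h => by
      have h1 := norm_half_le_norm_sub hN hL (hmem E hE) hz
      rw [← quarticRoot_pow_four h0, h] at h1
      have := norm_pos_iff.2 h0
      norm_num at h1
      linarith
    simp only [div_eq_zero_iff, mul_eq_zero, hroot 1 hp1, hroot (-1) hm1, hh', false_or,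
      or_false] at hG
    exact isEigenvalue_of_dirichlet hh hV (hφR E) (by simpa using hφl h E)
      (by simp [hφl' h E]) (by simpa using hG)
  · refine not_mem_Sp_of_dirichlet hh hV (hφR E) (hχR E) (by simpa using hφl h E)
      (by simpa using hχr h E) (by simpa using hχr' h E) fun h1 => hG ?_
    have : (φ h E).1 1 = 0 := by simpa using h1
    simp [this]

end Shooting

/-! ### Zeros of functions close to `sin (Z / h)`. -/

/-- On the unit circle `z - z³/6` has norm at least `5/6`, and the Taylor remainder is at most
`1/12`. -/
theorem Complex.norm_sin_ge_of_norm_eq_one {z : ℂ} (hz : ‖z‖ = 1) : 3 / 4 ≤ ‖Complex.sin z‖ := by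
  have h1 := Complex.sin_bound hz.le
  have h2 := norm_sub_norm_le z (z ^ 3 / 6)
  have h3 := norm_sub_norm_le (z - z ^ 3 / 6) (z - z ^ 3 / 6 - Complex.sin z)
  rw [sub_sub_cancel, norm_sub_rev (z - z ^ 3 / 6) (Complex.sin z)] at h3
  rw [norm_div, norm_pow, hz] at h2
  rw [hz] at h1
  norm_num at h1 h2
  linarith

/-- A function holomorphic near a closed disc that is smaller at the center than on the boundary
has a zero in the disc. -/
theorem exists_zero_of_norm_lt {f : ℂ → ℂ} {c : ℂ} {ρ m : ℝ} (hρ : 0 < ρ) (hm : 0 < m)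
    (hf : ∀ z ∈ Metric.closedBall c ρ, DifferentiableAt ℂ f z) (hc : ‖f c‖ < m)
    (hb : ∀ z ∈ Metric.sphere c ρ, m ≤ ‖f z‖) : ∃ z ∈ Metric.closedBall c ρ, f z = 0 := by
  by_contra! hne
  have hd : DiffContOnCl ℂ (fun z => (f z)⁻¹) (Metric.ball c ρ) := by
    refine DifferentiableOn.diffContOnCl fun z hz => ?_
    rw [closure_ball c hρ.ne'] at hz
    exact ((hf z hz).inv (hne z hz)).differentiableWithinAt
  have h1 := Complex.norm_le_of_forall_mem_frontier_norm_le Metric.isBounded_ball hd (C := m⁻¹)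
    (fun z hz => by
      rw [frontier_ball c hρ.ne'] at hz
      rw [norm_inv]
      exact inv_anti₀ hm (hb z hz)) (subset_closure (Metric.mem_ball_self hρ))
  rw [norm_inv, inv_le_inv₀ (norm_pos_iff.2 (hne c (Metric.mem_closedBall_self hρ.le))) hm] at h1
  linarith

/-- If `G h` is close to `sin (Z / h)` and `Z(E₀)` is real, then `G h` has a zero at distance `O(h)`
from `E₀`. -/
theorem exists_zero_near {Z : ℂ → ℂ} {E₀ : ℂ} {R : ℝ} (hR : 0 < R)
    (hZ : DifferentiableOn ℂ Z (Metric.ball E₀ R)) {z₁ : ℂ} (hz₁ : HasDerivAt Z z₁ E₀)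
    (hz₁0 : z₁ ≠ 0) (hre : (Z E₀).im = 0) {G : ℝ → ℂ → ℂ} {K : ℝ} (hK : 0 < K)
    (hG : ∀ h : ℝ, 0 < h → h * K ≤ 1 → DifferentiableOn ℂ (G h) (Metric.ball E₀ R) ∧
      ∀ E ∈ Metric.ball E₀ R, ‖G h E - Complex.sin (Z E / h)‖ ≤
        h * K * Real.exp (|(Z E).im| / h)) :
    ∃ h₀ > (0 : ℝ), ∀ h : ℝ, 0 < h → h < h₀ →
      ∃ E ∈ Metric.ball E₀ R, G h E = 0 ∧ ‖E - E₀‖ ≤ 6 / ‖z₁‖ * h := by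
  have hcd : ContDiffAt ℂ 1 Z E₀ :=
    (hZ.analyticAt (Metric.ball_mem_nhds E₀ hR)).contDiffAt
  have hst : HasStrictDerivAt Z z₁ E₀ := hcd.hasStrictDerivAt' hz₁ one_ne_zero
  have hFD : HasFDerivAt Z
      ((ContinuousLinearEquiv.unitsEquivAut ℂ (Units.mk0 z₁ hz₁0) : ℂ ≃L[ℂ] ℂ) : ℂ →L[ℂ] ℂ) E₀ :=
    hst.hasStrictFDerivAt_equiv hz₁0 |>.hasFDerivAt
  set ψ := hcd.localInverse hFD one_ne_zero with hψ
  have hψc : ContDiffAt ℂ 1 ψ (Z E₀) := hcd.to_localInverse hFD one_ne_zero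
  have hψ0 : ψ (Z E₀) = E₀ := hcd.localInverse_apply_image hFD one_ne_zero
  have hright : ∀ᶠ ζ in 𝓝 (Z E₀), Z (ψ ζ) = ζ :=
    (hst.hasStrictFDerivAt_equiv hz₁0).eventually_right_inverse
  have hψd : HasDerivAt ψ z₁⁻¹ (Z E₀) :=
    (hst.to_localInverse hz₁0).hasDerivAt
  have hdiff : ∀ᶠ ζ in 𝓝 (Z E₀), DifferentiableAt ℂ ψ ζ := by
    filter_upwards [hψc.eventually (by simp)] with ζ h
    exact h.differentiableAt one_ne_zero
  have hball : ∀ᶠ ζ in 𝓝 (Z E₀), ψ ζ ∈ Metric.ball E₀ R := by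
    refine hψc.continuousAt ?_
    rw [hψ0]; exact Metric.ball_mem_nhds _ hR
  have hlip : ∀ᶠ ζ in 𝓝 (Z E₀), ‖ψ ζ - E₀‖ ≤ 2 / ‖z₁‖ * ‖ζ - Z E₀‖ := by
    have h1 := (hasDerivAt_iff_isLittleO.1 hψd).def (c := 1 / ‖z₁‖)
      (one_div_pos.2 (norm_pos_iff.2 hz₁0))
    filter_upwards [h1] with ζ h
    rw [hψ0, smul_eq_mul] at h
    have h2 := norm_le_norm_add_norm_sub' (ψ ζ - E₀) ((ζ - Z E₀) * z₁⁻¹)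
    rw [norm_mul, norm_inv] at h2
    calc ‖ψ ζ - E₀‖ ≤ ‖ζ - Z E₀‖ * ‖z₁‖⁻¹ + 1 / ‖z₁‖ * ‖ζ - Z E₀‖ := by linarith
      _ = _ := by ring
  obtain ⟨ρ, hρ, hall⟩ := Metric.eventually_nhds_iff_ball.1
    (hright.and (hdiff.and (hball.and hlip)))
  -- `ρ / 3` keeps a disc of radius `3h` in the domain of the local inverse; `1 / (12 K)` and `e ≤
  -- 3` make the error at most `1/4`.
  refine ⟨min (ρ / 3) (1 / (12 * K)), by positivity, fun h hh hlt => ?_⟩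
  have hh' : (h : ℂ) ≠ 0 := by exact_mod_cast hh.ne'
  have hρ3 : h * 3 < ρ := by
    have := hlt.trans_le (min_le_left _ _); linarith
  have hK12 : h * K ≤ 1 / 12 := by
    have := (hlt.trans_le (min_le_right _ _)).le
    rw [le_div_iff₀ (by positivity)] at this
    linarith
  obtain ⟨hGd, hGs⟩ := hG h hh (by linarith)
  -- `c = kπh` is the zero of `sin (·/h)` nearest to the real number `Z E₀`.
  set k : ℤ := round ((Z E₀).re / (Real.pi * h)) with hk
  set c : ℂ := ((k * Real.pi * h : ℝ) : ℂ) with hc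
  have hcZ : ‖c - Z E₀‖ ≤ 2 * h := by
    have e1 : Z E₀ = (((Z E₀).re : ℝ) : ℂ) := by
      apply Complex.ext <;> simp [hre]
    rw [e1, hc, ← Complex.ofReal_sub, Complex.norm_real, Real.norm_eq_abs, abs_sub_comm]
    have h1 := abs_sub_round ((Z E₀).re / (Real.pi * h))
    rw [← hk] at h1
    have hp : 0 < Real.pi * h := by positivity
    have e2 : (Z E₀).re - k * Real.pi * h =
        ((Z E₀).re / (Real.pi * h) - k) * (Real.pi * h) := by
      field_simp
    rw [e2, abs_mul, abs_of_pos hp]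
    have := Real.pi_lt_four
    nlinarith
  have hsub : ∀ ζ ∈ Metric.closedBall c h, ‖ζ - Z E₀‖ ≤ 3 * h := by
    intro ζ hζ
    have h1 := norm_add_le (ζ - c) (c - Z E₀)
    rw [sub_add_sub_cancel] at h1
    have := mem_closedBall_iff_norm.1 hζ
    linarith
  have hsub' : ∀ ζ ∈ Metric.closedBall c h, ζ ∈ Metric.ball (Z E₀) ρ := fun ζ hζ =>
    mem_ball_iff_norm.2 ((hsub ζ hζ).trans_lt (by linarith))
  have hexp : Real.exp 1 ≤ 3 := by linarith [Real.exp_one_lt_d9]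
  have hclose : ∀ ζ ∈ Metric.closedBall c h, ‖G h (ψ ζ) - Complex.sin (ζ / h)‖ ≤ 1 / 4 := by
    intro ζ hζ
    obtain ⟨h1, -, h3, -⟩ := hall ζ (hsub' ζ hζ)
    have h4 := hGs _ h3
    rw [h1] at h4
    have h5 : |ζ.im| / h ≤ 1 := by
      rw [div_le_one hh]
      have h6 := (Complex.abs_im_le_norm (ζ - c)).trans (mem_closedBall_iff_norm.1 hζ)
      rwa [Complex.sub_im, hc, Complex.ofReal_im, sub_zero] at h6
    have h7 : Real.exp (|ζ.im| / h) ≤ 3 := (Real.exp_le_exp.2 h5).trans hexp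
    calc ‖G h (ψ ζ) - Complex.sin (ζ / h)‖ ≤ h * K * Real.exp (|ζ.im| / h) := h4
      _ ≤ 1 / 12 * 3 := by gcongr
      _ = 1 / 4 := by norm_num
  have hper : ∀ w : ℂ, ‖Complex.sin (w + k * Real.pi)‖ = ‖Complex.sin w‖ := by
    intro w
    rw [Complex.sin_antiperiodic.add_int_mul_eq k, Int.cast_negOnePow]
    rcases Int.even_or_odd k with hk | hk
    · rw [hk.neg_one_zpow, one_mul]
    · rw [hk.neg_one_zpow, neg_one_mul, norm_neg]
  have hsinζ : ∀ ζ : ℂ, ‖Complex.sin (ζ / h)‖ = ‖Complex.sin ((ζ - c) / h)‖ := by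
    intro ζ
    rw [← hper ((ζ - c) / h)]
    congr 2
    rw [hc]; push_cast
    field_simp
    ring
  -- At the center the function is at most `1/4`; on the circle of radius `h` it is at least `3/4 -
  -- 1/4 = 1/2`.
  obtain ⟨ζ, hζ, hζ0⟩ := exists_zero_of_norm_lt (f := fun ζ => G h (ψ ζ)) (c := c) hh
    (m := 1 / 2) (by norm_num)
    (fun ζ hζ => by
      obtain ⟨-, h2, h3, -⟩ := hall ζ (hsub' ζ hζ)
      exact (hGd.differentiableAt (Metric.isOpen_ball.mem_nhds h3)).comp ζ h2)
    (by
      have h1 := hclose c (Metric.mem_closedBall_self hh.le)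
      have h2 := norm_le_norm_add_norm_sub' (G h (ψ c)) (Complex.sin (c / h))
      rw [hsinζ, sub_self, zero_div, Complex.sin_zero, norm_zero] at h2
      linarith)
    (fun ζ hζ => by
      have h1 := hclose ζ (Metric.sphere_subset_closedBall hζ)
      have h2 := norm_le_norm_add_norm_sub (G h (ψ ζ)) (Complex.sin (ζ / h))
      rw [hsinζ] at h2
      have h3 := Complex.norm_sin_ge_of_norm_eq_one (z := (ζ - c) / h) (by
        rw [norm_div, mem_sphere_iff_norm.1 hζ, Complex.norm_real, Real.norm_of_nonneg hh.le,
          div_self hh.ne'])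
      linarith)
  obtain ⟨-, -, h3, h4⟩ := hall ζ (hsub' ζ hζ)
  refine ⟨ψ ζ, h3, hζ0, h4.trans ?_⟩
  calc 2 / ‖z₁‖ * ‖ζ - Z E₀‖ ≤ 2 / ‖z₁‖ * (3 * h) := by gcongr; exact hsub ζ hζ
    _ = _ := by ring

/-- If `Z(E₀)` is not real, then a function close to `sin (Z / h)` does not vanish near `E₀` for
small `h`. -/
theorem ne_zero_near {Z : ℂ → ℂ} {E₀ : ℂ} {R : ℝ} (hR : 0 < R) (hZ : ContinuousAt Z E₀)
    (him : (Z E₀).im ≠ 0) {G : ℝ → ℂ → ℂ} {K : ℝ} (hK : 0 < K)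
    (hG : ∀ h : ℝ, 0 < h → h * K ≤ 1 → ∀ E ∈ Metric.ball E₀ R,
      ‖G h E - Complex.sin (Z E / h)‖ ≤ h * K * Real.exp (|(Z E).im| / h)) :
    ∃ h₀ > (0 : ℝ), ∀ᶠ E in 𝓝 E₀, ∀ h : ℝ, 0 < h → h < h₀ → G h E ≠ 0 := by
  have hpos : 0 < |(Z E₀).im| := abs_pos.2 him
  -- With `x = |Im Z|/h ≥ 1`, a zero would give `(e^x - 1)/2 ≤ e^x/4`, that is `e^x ≤ 2`.
  refine ⟨min (1 / (4 * K)) (|(Z E₀).im| / 2), by positivity, ?_⟩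
  have hev : ∀ᶠ E in 𝓝 E₀, |(Z E₀).im| / 2 < |(Z E).im| :=
    (continuous_abs.continuousAt.comp (Complex.continuous_im.continuousAt.comp hZ)).eventually_const_lt
      (by simp only [Function.comp]; linarith)
  filter_upwards [hev, Metric.ball_mem_nhds E₀ hR] with E h1 hE h hh hlt h0
  have hK4 : h * K ≤ 1 / 4 := by
    have := (hlt.trans_le (min_le_left _ _)).le
    rw [le_div_iff₀ (by positivity)] at this
    linarith
  have h2 := hG h hh (by linarith) E hE
  rw [h0, zero_sub, norm_neg] at h2
  have h3 := Complex.exp_abs_im_sub_one_le_norm_sin (Z E / h)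
  rw [Complex.div_ofReal_im, abs_div, abs_of_pos hh] at h3
  have h4 : 1 ≤ |(Z E).im| / h := by
    rw [one_le_div hh]
    have := hlt.trans_le (min_le_right _ _)
    linarith
  have h5 := Real.add_one_le_exp (|(Z E).im| / h)
  have h6 : 2 < Real.exp (|(Z E).im| / h) := by
    have := Real.add_one_lt_exp (x := |(Z E).im| / h) (by linarith)
    linarith
  have h7 := mul_le_mul_of_nonneg_right hK4 (Real.exp_pos (|(Z E).im| / h)).le
  linarith

/-! ### From energies to their square roots. -/

theorem tendsto_of_tendsto_cpow_half {ι : Type*} {l : Filter ι} {E : ι → ℂ} {E₀ : ℂ}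
    (h : Tendsto (fun i => E i ^ (1 / 2 : ℂ)) l (𝓝 (E₀ ^ (1 / 2 : ℂ)))) : Tendsto E l (𝓝 E₀) := by
  have := h.pow 2
  simpa only [Complex.cpow_half_sq] using this

/-- If the action at `E₀` is real, then `√E₀` has a large real part. -/
theorem half_norm_le_re_cpow_half {E₀ J : ℂ} (hJ : ‖J - 2‖ ≤ 1 / 4)
    (h : (E₀ ^ (1 / 2 : ℂ) * J).im = 0) :
    ‖E₀ ^ (1 / 2 : ℂ)‖ / 2 ≤ (E₀ ^ (1 / 2 : ℂ)).re := by
  have h1 := Complex.cpow_half_re_nonneg E₀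
  set p := E₀ ^ (1 / 2 : ℂ) with hp
  have h2 := abs_le.1 ((Complex.abs_re_le_norm _).trans hJ)
  have h3 := abs_le.1 ((Complex.abs_im_le_norm _).trans hJ)
  simp only [Complex.sub_re, Complex.sub_im, Complex.re_ofNat, Complex.im_ofNat, sub_zero] at h2 h3
  rw [Complex.mul_im] at h
  -- `Im (p J) = 0` with `J` near `2` makes `p` nearly real.
  have h4 : |p.im| ≤ p.re := by
    rw [abs_le]
    constructor <;> nlinarith
  have h5 := Complex.norm_le_abs_re_add_abs_im p
  rw [abs_of_nonneg h1] at h5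
  linarith

/-- Factor `E - E₀`; both principal roots have nonnegative real part, so their sum is at least `Re
√E₀` in norm. -/
theorem norm_cpow_half_sub_le {E E₀ : ℂ}
    (h : ‖E₀ ^ (1 / 2 : ℂ)‖ / 2 ≤ (E₀ ^ (1 / 2 : ℂ)).re) :
    ‖E ^ (1 / 2 : ℂ) - E₀ ^ (1 / 2 : ℂ)‖ * (‖E₀ ^ (1 / 2 : ℂ)‖ / 2) ≤ ‖E - E₀‖ := by
  have h1 : E - E₀ = (E ^ (1 / 2 : ℂ) - E₀ ^ (1 / 2 : ℂ)) * (E ^ (1 / 2 : ℂ) + E₀ ^ (1 / 2 : ℂ)) := by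
    linear_combination -Complex.cpow_half_sq E + Complex.cpow_half_sq E₀
  rw [h1, norm_mul]
  refine mul_le_mul_of_nonneg_left (le_trans ?_ (Complex.re_le_norm _)) (norm_nonneg _)
  rw [Complex.add_re]
  linarith [Complex.cpow_half_re_nonneg E]

/-! ### Both inclusions and the conclusion. -/

section Main

variable {V : ℂ → ℂ} {N : Set ℂ} {δ M r η : ℝ} {E₀ : ℂ}

theorem exists_eigenvalue_near (hN : IsGoodNeighborhood V N δ M r) (hL : IsLargeEnergy δ M η E₀)
    (hη : 0 < η) (him : (action V E₀ E₀).im = 0) :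
    ∃ h₀ > (0 : ℝ), ∀ h : ℝ, 0 < h → h < h₀ →
      ∃ E : ℂ, IsEigenvalue h V E ∧ ‖E ^ (1 / 2 : ℂ) - E₀ ^ (1 / 2 : ℂ)‖ ≤ 24 * h := by
  have hE0 : 0 < ‖E₀‖ := norm_pos_iff.2 hL.ne_zero
  have hR : 0 < η / 2 * ‖E₀‖ := by positivity
  have hp : 0 < ‖E₀ ^ (1 / 2 : ℂ)‖ := norm_pos_iff.2 fun h => hL.ne_zero (by
    rw [← Complex.cpow_half_sq E₀, h]; simp)
  obtain ⟨G, K, hK, hG⟩ := exists_characteristic_function hN hL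
  have hd := hasDerivAt_action (E := E₀) hN hL (by simpa using hR)
  have hle := le_norm_deriv_action (E := E₀) hN hL (by simpa using hR.le)
  set z₁ := E₀ ^ (1 / 2 : ℂ) *
    ∫ x in (-1 : ℝ)..1, 1 / (2 * E₀) * (((E₀ - V x) / E₀) ^ (1 / 2 : ℂ))⁻¹ with hz₁
  have hz₁pos : 0 < ‖z₁‖ := lt_of_lt_of_le (by positivity) hle
  obtain ⟨h₀, hh₀, hzero⟩ := exists_zero_near hR
    (fun E hE => (hasDerivAt_action hN hL (mem_ball_iff_norm.1 hE)).differentiableAt.differentiableWithinAt)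
    hd (norm_pos_iff.1 hz₁pos) him hK
    (fun h hh hhK => ⟨(hG h hh hhK).1, fun E hE => ((hG h hh hhK).2 E hE).1⟩)
  refine ⟨min h₀ (1 / K), by positivity, fun h hh hlt => ?_⟩
  obtain ⟨E, hE, hGE, hdist⟩ := hzero h hh (hlt.trans_le (min_le_left _ _))
  have hhK : h * K ≤ 1 := by
    have := (hlt.trans_le (min_le_right _ _)).le
    rwa [le_div_iff₀ hK] at this
  refine ⟨E, ((hG h hh hhK).2 E hE).2.1 hGE, ?_⟩
  have hJ := norm_actionRatio_sub_two_le (E := E₀) hN hL (by simpa using hR.le)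
  have h1 := norm_cpow_half_sub_le (E := E)
    (half_norm_le_re_cpow_half (hJ.trans (by linarith [hL.le_eighth])) him)
  -- Here `24` arises: `|E - E₀| ≤ 12 |√E₀| h`, divided by `|√E₀| / 2`.
  have h2 : 6 / ‖z₁‖ ≤ 12 * ‖E₀ ^ (1 / 2 : ℂ)‖ := by
    rw [div_le_iff₀ (by positivity)] at hle
    rw [div_le_iff₀ hz₁pos]
    linarith
  have h3 := mul_le_mul_of_nonneg_right h2 hh.le
  refine le_of_mul_le_mul_right ?_ (half_pos hp)
  linarith

theorem action_im_eq_zero_of_mem_limSp (hN : IsGoodNeighborhood V N δ M r)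
    (hL : IsLargeEnergy δ M η E₀) (hη : 0 < η) (h : E₀ ∈ limSp V) : (action V E₀ E₀).im = 0 := by
  by_contra him
  obtain ⟨hs, E, hpos, hlim, hSp, hE⟩ := h
  have hE0 : 0 < ‖E₀‖ := norm_pos_iff.2 hL.ne_zero
  have hR : 0 < η / 2 * ‖E₀‖ := by positivity
  obtain ⟨G, K, hK, hG⟩ := exists_characteristic_function hN hL
  obtain ⟨h₀, hh₀, hev⟩ := ne_zero_near hR
    (hasDerivAt_action (E := E₀) hN hL (by simpa using hR)).continuousAt him hK
    (fun h hh hhK E hE => ((hG h hh hhK).2 E hE).1)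
  have e1 := hE.eventually hev
  have e2 := hE.eventually (Metric.ball_mem_nhds E₀ hR)
  have e3 := hlim.eventually_lt_const hh₀
  have e4 := hlim.eventually_lt_const (one_div_pos.2 hK)
  obtain ⟨j, h1, h2, h3, h4⟩ := (e1.and (e2.and (e3.and e4))).exists
  have hhK : hs j * K ≤ 1 := by
    have := h4.le
    rwa [le_div_iff₀ hK] at this
  exact ((hG (hs j) (hpos j) hhK).2 (E j) h2).2.2 (h1 (hs j) (hpos j) h3) (hSp j)

end Main

/-! The proof of the main theorem uses `V` near `[-1, 1]` only. For large `|E|` the function `V - E`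
has no zero there, and `[-1, 1]` can be deformed, within a fixed neighborhood, to a curve that
`∫ √(E - V)` maps to a segment; the hypotheses `HypH1`, `HypH2` and the connectedness of `D` are not
needed. -/

theorem theorem4p1 (D : Set ℂ) (V : ℂ → ℂ) (hDo : IsOpen D) (hDc : IsConnected D)
    (hD : ∀ x ∈ Icc (-1 : ℝ) 1, (x : ℂ) ∈ D) (hV : DifferentiableOn ℂ V D)
    (h1 : HypH1 D V) (h2 : HypH2 D V) :
    ∃ R > (0 : ℝ), ∃ ε > (0 : ℝ), ∃ C > (0 : ℝ), ∀ E₀ : ℂ, LargeNearReal R ε E₀ →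
      (ActionReZero V E₀ ↔ E₀ ∈ limSp V) ∧
      (ActionReZero V E₀ → ∃ h₀ > (0 : ℝ), ∀ h : ℝ, 0 < h → h < h₀ →
        ∃ E : ℂ, IsEigenvalue h V E ∧ E ∈ Sp h V ∧
          ‖E ^ (1 / 2 : ℂ) - E₀ ^ (1 / 2 : ℂ)‖ ≤ C * h) := by
  obtain ⟨N, δ, M, r, hN⟩ := exists_isGoodNeighborhood hDo hD hV
  have hδ := hN.pos
  -- `δ / 8` yields `4η ≤ δ/2 ≤ (1 - η) δ`, the room needed to deform the path.
  set η : ℝ := min (1 / 8) (δ / 8) with hη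
  have hη0 : 0 < η := by positivity
  have hη1 : η ≤ 1 / 8 := min_le_left _ _
  have hη2 : η ≤ δ / 8 := min_le_right _ _
  have hM0 : 0 ≤ M := (norm_nonneg _).trans (hN.norm_le _ (hN.mem (x := 0) (by norm_num)))
  -- `|E₀| ≥ 2M/η` means `M ≤ (η/2) |E₀|`, and the `+ 1` excludes `E₀ = 0`. With `ε = 1` the bound
  -- on `Im E₀` holds for every `E₀`.
  refine ⟨2 * M / η + 1, by positivity, 1, one_pos, 24, by norm_num, fun E₀ hE₀ => ?_⟩
  have hL : IsLargeEnergy δ M η E₀ := by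
    have hR := hE₀.1
    have hq : 0 ≤ 2 * M / η := by positivity
    refine ⟨norm_pos_iff.1 (by linarith), hη0.le, hη1, by nlinarith, ?_⟩
    have h3 : 2 * M / η ≤ ‖E₀‖ := by linarith
    rw [div_le_iff₀ hη0] at h3
    linarith
  have hpart2 : ActionReZero V E₀ → ∃ h₀ > (0 : ℝ), ∀ h : ℝ, 0 < h → h < h₀ →
      ∃ E : ℂ, IsEigenvalue h V E ∧ E ∈ Sp h V ∧
        ‖E ^ (1 / 2 : ℂ) - E₀ ^ (1 / 2 : ℂ)‖ ≤ 24 * h := by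
    intro hA
    obtain ⟨h₀, hh₀, H⟩ := exists_eigenvalue_near hN hL hη0 ((actionReZero_iff hN hL).1 hA)
    refine ⟨h₀, hh₀, fun h hh hlt => ?_⟩
    obtain ⟨E, hE, hb⟩ := H h hh hlt
    exact ⟨E, hE, hE.mem_Sp, hb⟩
  refine ⟨⟨fun hA => ?_, fun h => (actionReZero_iff hN hL).2
    (action_im_eq_zero_of_mem_limSp hN hL hη0 h)⟩, hpart2⟩
  obtain ⟨h₀, hh₀, H⟩ := hpart2 hA
  -- The shift by `2` makes the term at `j = 0` strictly less than `h₀`.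
  have hpos : ∀ j : ℕ, 0 < h₀ / (j + 2 : ℝ) := fun j => by positivity
  have hlt : ∀ j : ℕ, h₀ / (j + 2 : ℝ) < h₀ := fun j =>
    div_lt_self hh₀ (by have : (0 : ℝ) ≤ j := j.cast_nonneg; linarith)
  choose E _ hSp hb using fun j : ℕ => H _ (hpos j) (hlt j)
  have hlim : Tendsto (fun j : ℕ => h₀ / (j + 2 : ℝ)) atTop (𝓝 0) :=
    (tendsto_natCast_atTop_atTop.atTop_add tendsto_const_nhds).const_div_atTop h₀
  refine ⟨fun j => h₀ / (j + 2 : ℝ), E, hpos, hlim, hSp, tendsto_of_tendsto_cpow_half ?_⟩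
  rw [tendsto_iff_norm_sub_tendsto_zero]
  refine squeeze_zero (fun _ => norm_nonneg _) hb ?_
  simpa using hlim.const_mul 24
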